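/- Let $m,n\ge 1$ be integers and let $0<\delta\le\Delta$. Let $\mathcal X:=\{x\in\mathbb Z_+^n:\sum_{i=1}^n x_i=m\}$ be the set of configurations of $m$ particles on $n$ sites, and for each site $i$ let $r_i:\mathbb Z_+\to[0,\infty)$ be a function with $r_i(0)=0$ and $$\delta\le r_i(k+1)-r_i(k)\le\Delta\qquad\text{for all }k\in\mathbb Z_+.$$ The mean-field Zero-Range Process with these rates is the Markov chain on $\mathcal X$ with generator $$(Qf)(x)=\frac1n\sum_{i,j=1}^n r_i(x_i)\bigl(f(x+\delta_j-\delta_i)-f(x)\bigr),$$ where $\delta_1,\dots,\delta_n$ is the canonical basis of $\mathbb R^n$ and terms with $x_i=0$ vanish. Let $Q(x,y)$ be its matrix entries and let $\pi$ be the probability measure on $\mathcal X$ with respect to which $Q$ is reversible, i.e. $\pi(x)Q(x,y)=\pi(y)Q(y,x)$ for all $x,y$. Write $\mathbf E$ for expectation with respect to $\pi$, $\mathrm{Ent}(f)=\mathbf E[f\log f]-\mathbf E[f]\log\mathbf E[f]$, and $\mathcal E(f,g)=\frac12\sum_{x,y\in\mathcal X}\pi(x)Q(x,y)(f(x)-f(y))(g(x)-g(y))$,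 and let the log-Sobolev constant $\mathrm t_{\mathrm{ls}}$ be the smallest $t\ge0$ such that $$\mathrm{Ent}(f)\le t\,\mathcal E(\sqrt f,\sqrt f)\qquad\text{for all }f:\mathcal X\to(0,\infty).$$ Then $$\mathrm t_{\mathrm{ls}}\le\frac{40\Delta}{\delta^2}\log\left(\frac{\Delta mn}{\delta}\right).$$ -/

import Mathlib

open scoped BigOperators ENNReal NNReal

noncomputable section

/-! ### Functional inequalities for reversible Markov generators on a finite state space -/

namespace MarkovChain

variable {X : Type*} [Fintype X]

/-- `π` is a probability vector on `X` and the generator with entries `Q x y` is reversible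
with respect to `π` (detailed balance). -/
structure IsReversible (Q : X → X → ℝ) (π : X → ℝ) : Prop where
  nonneg : ∀ x, 0 ≤ π x
  sum_eq_one : ∑ x, π x = 1
  detailed_balance : ∀ x y, π x * Q x y = π y * Q y x

/-- The Dirichlet form `𝓔(f, g)`. -/
def dirichletForm (Q : X → X → ℝ) (π : X → ℝ) (f g : X → ℝ) : ℝ :=
  (1 / 2) * ∑ x, ∑ y, π x * Q x y * (f x - f y) * (g x - g y)

/-- Expectation with respect to `π`. -/
def expect (π : X → ℝ) (f : X → ℝ) : ℝ := ∑ x, π x * f x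

/-- The entropy `Ent(f) = E[f log f] - E[f] log E[f]`. -/
def entropy (π : X → ℝ) (f : X → ℝ) : ℝ :=
  expect π (fun x => f x * Real.log (f x)) - expect π f * Real.log (expect π f)

/-- The log-Sobolev inequality with constant `t`. -/
def LogSobolev (Q : X → X → ℝ) (π : X → ℝ) (t : ℝ) : Prop :=
  ∀ f : X → ℝ, (∀ x, 0 < f x) →
    entropy π f ≤ t * dirichletForm Q π (fun x => √(f x)) (fun x => √(f x))

/-- The log-Sobolev constant `t_ls`: the optimal (smallest) `t ≥ 0` in the log-Sobolev inequality,
with value `∞` if no finite constant works. -/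
def logSobolevConst (Q : X → X → ℝ) (π : X → ℝ) : ℝ≥0∞ :=
  ⨅ (t : ℝ≥0) (_ : LogSobolev Q π t), (t : ℝ≥0∞)

end MarkovChain

/-! ### The Zero-Range Process -/

namespace ZeroRange

/-- The configurations of `m` particles on `n` sites. -/
abbrev Config (m n : ℕ) : Type := {x : Fin n → ℕ // ∑ i, x i = m}

instance (m n : ℕ) : Fintype (Config m n) :=
  Fintype.subtype (Finset.piAntidiag Finset.univ m) (fun x => by simp)

variable {m n : ℕ}

theorem sum_move (x : Fin n → ℕ) (hx : ∑ k, x k = m) (i j : Fin n) (h : 0 < x i) :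
    ∑ k, (x - Pi.single i 1 + Pi.single j 1 : Fin n → ℕ) k = m := by
  have hle : ∀ k ∈ Finset.univ, (Pi.single i 1 : Fin n → ℕ) k ≤ x k := by
    intro k _
    by_cases hk : k = i
    · subst hk; simpa using Nat.succ_le_of_lt h
    · simp [hk]
  have h1 : ∑ k, (Pi.single i 1 : Fin n → ℕ) k = 1 := by simp
  have h2 : ∑ k, (Pi.single j 1 : Fin n → ℕ) k = 1 := by simp
  have h3 : x i ≤ ∑ k, x k := Finset.single_le_sum (fun _ _ => Nat.zero_le _) (Finset.mem_univ i)
  simp only [Pi.add_apply, Pi.sub_apply]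
  rw [Finset.sum_add_distrib, Finset.sum_tsub_distrib _ hle, h1, h2]
  omega

/-- The configuration `x + δ_j - δ_i`, obtained by moving one particle from site `i` to site `j`.
If site `i` is empty it is `x` itself; such moves have rate zero. -/
def move (x : Config m n) (i j : Fin n) : Config m n :=
  if h : 0 < x.1 i then ⟨x.1 - Pi.single i 1 + Pi.single j 1, sum_move x.1 x.2 i j h⟩ else x

/-- The action of the generator of the Zero-Range Process with rate functions `r i` (where
`r i k` is the rate at which site `i` expels a particle when it holds `k` of them) and geometry
`G`. -/
def generator (r : Fin n → ℕ → ℝ) (G : Matrix (Fin n) (Fin n) ℝ) (f : Config m n → ℝ)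
    (x : Config m n) : ℝ :=
  ∑ i, ∑ j, r i (x.1 i) * G i j * (f (move x i j) - f x)

/-- The matrix entry `Q(x, y)` of the generator, i.e. `(Q 1_y)(x)`. -/
def rate (r : Fin n → ℕ → ℝ) (G : Matrix (Fin n) (Fin n) ℝ) (x y : Config m n) : ℝ :=
  generator r G (Pi.single y 1) x

/-- The mean-field geometry: all entries are equal to `1 / n`. -/
def meanField (n : ℕ) : Matrix (Fin n) (Fin n) ℝ := fun _ _ => 1 / (n : ℝ)

end ZeroRange

end

/-! # A log-Sobolev inequality for the mean-field zero-range process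

The reversible probability vector is proportional to the product weight `ZeroRange.weight`, whose
factor at a site holding `k` particles is `1 / (r 1 ⋯ r k)`. In terms of this weight an edge of the
process is a configuration with one particle removed, together with the two sites between which the
missing particle may jump. The inequality is proved for every set `S` of sites by induction on its
cardinality (`ZeroRange.card_mul_weightedEntropy_le`). The chain rule splits the entropy into its
conditional part given the number of particles at a site `i`, which is handled by the induction
hypothesis, and the entropy of the law of that number; averaging over `i ∈ S` closes the induction
with a constant that does not deteriorate.

The number of particles at `i` is reversible for a birth-death chain with nonincreasing birth rates
and death rates whose increments are at least `δ`. Two copies of such a chain started from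
neighbouring states merge at rate at least `δ`, so its resolvent `δ (δ - gen)⁻¹` halves every
Dirichlet form of the type `∑ c Φ(f (k + 1), f k)` with `Φ` jointly convex, one-homogeneous and
vanishing on the diagonal, in particular that of `Φ(a, b) = (√a - √b)²`
(`IsMonotoneBirthDeath.IsResolvent.energy_le`). On the other hand the resolvent equation bounds the
ratio of the values of a resolvent at neighbouring states by the ratio of rates. The entropy lost in
one step of the resolvent is therefore at most the Dirichlet form of `√f` times the logarithm of
that ratio (`IsMonotoneBirthDeath.IsResolvent.weightedEntropy_le`), and summing the resulting
geometric series gives the log-Sobolev inequality `IsMonotoneBirthDeath.logSobolev`.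

To pass from the one-site chain to the whole process, the conditional equilibria given `k` and
`k + 1` particles at `i` are coupled so that they differ by the position of one particle
(`ZeroRange.exists_coupling`). The coupling is the stationary law of a zero-range process with one
marked extra particle which jumps to a uniform site at a rate in `[δ, Δ]`; the maximum principle
shows that, given the other particles, the marked one is at any given site with probability at most
`Δ / δ` divided by the number of sites. Joint convexity of `(√a - √b)²` then transfers the energy
(`ZeroRange.energy_siteMean_le`). The same coupling gives the monotonicity of the birth rates. -/

/-! ### Scalar inequalities -/

theorem log_sub_log_le_of_le {u v : ℝ} (hv : 0 < v) (huv : v ≤ u) :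
    Real.log u - Real.log v ≤ (u ^ 2 - v ^ 2) / (2 * u * v) := by
  have hu : 0 < u := hv.trans_le huv
  have hs : 0 < u / v := div_pos hu hv
  have h0 : 0 ≤ Real.log (u / v) := Real.log_nonneg ((one_le_div hv).2 huv)
  have h := Real.self_le_sinh_iff.2 h0
  rw [Real.sinh_log hs, Real.log_div hu.ne' hv.ne'] at h
  refine h.trans_eq ?_
  field_simp

theorem log_sub_log_le_of_ge {u v : ℝ} (hu : 0 < u) (huv : u ≤ v) :
    Real.log u - Real.log v ≤ 2 * (u - v) / (u + v) := by
  have hv : 0 < v := hu.trans_le huv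
  have h1 : 0 ≤ v / u - 1 := sub_nonneg.2 ((one_le_div hu).2 huv)
  have h := Real.le_log_one_add_of_nonneg h1
  rw [add_sub_cancel, Real.log_div hv.ne' hu.ne'] at h
  have e : 2 * (v / u - 1) / (v / u - 1 + 2) = -(2 * (u - v) / (u + v)) := by
    have : v / u - 1 + 2 = (u + v) / u := by field_simp; ring
    rw [this]; field_simp; ring
  linarith

/-- The pointwise relative entropy is comparable to the squared Hellinger distance, at the price of
the logarithm of the density. -/
theorem relEntropy_le_sq_sqrt_sub {a b ρ : ℝ} (ha : 0 < a) (hb : 0 < b) (hρ : 0 ≤ ρ)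
    (h : Real.log a - Real.log b ≤ ρ) :
    a * (Real.log a - Real.log b) - a + b ≤ (2 + ρ) * (√a - √b) ^ 2 := by
  obtain ⟨u, hu, rfl⟩ : ∃ u, 0 < u ∧ a = u ^ 2 := ⟨√a, by positivity, (Real.sq_sqrt ha.le).symm⟩
  obtain ⟨v, hv, rfl⟩ : ∃ v, 0 < v ∧ b = v ^ 2 := ⟨√b, by positivity, (Real.sq_sqrt hb.le).symm⟩
  rw [Real.sqrt_sq hu.le, Real.sqrt_sq hv.le, Real.log_pow, Real.log_pow] at *
  push_cast at *
  set ℓ := Real.log u - Real.log v with hℓ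
  have e1 : 2 * Real.log u - 2 * Real.log v = 2 * ℓ := by rw [hℓ]; ring
  rw [e1] at h ⊢
  rcases le_total v u with huv | huv
  · have h1 := log_sub_log_le_of_le hv huv
    rw [← hℓ, le_div_iff₀ (by positivity)] at h1
    have h2 : 2 * ℓ * (u - v) ^ 2 ≤ ρ * (u - v) ^ 2 := by gcongr
    have h3 : 0 ≤ u * ((u - v) * (3 * u - v) - 2 * ℓ * (v * (2 * u - v))) := by
      have : ℓ * (2 * u * v) * (2 * u - v) ≤ (u ^ 2 - v ^ 2) * (2 * u - v) := by
        apply mul_le_mul_of_nonneg_right h1; linarith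
      have h5 : 0 ≤ (u - v) ^ 3 := by
        have : 0 ≤ u - v := by linarith
        positivity
      nlinarith
    have h4 := nonneg_of_mul_nonneg_right h3 hu
    nlinarith
  · have h1 := log_sub_log_le_of_ge hu huv
    rw [← hℓ, le_div_iff₀ (by positivity)] at h1
    have h2 : 0 ≤ ρ * (u - v) ^ 2 := by positivity
    have h3 : 0 ≤ (u + v) * (2 * (u - v) ^ 2 - (2 * u ^ 2 * ℓ - u ^ 2 + v ^ 2)) := by
      have : u ^ 2 * (ℓ * (u + v)) ≤ u ^ 2 * (2 * (u - v)) := by gcongr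
      have h5 : 0 ≤ (v - u) * (v - u) ^ 2 := mul_nonneg (by linarith) (sq_nonneg _)
      nlinarith
    have h4 := nonneg_of_mul_nonneg_right h3 (by positivity)
    nlinarith

theorem sub_mul_log_sub_le_of_le {a b ρ : ℝ} (hb : 0 < b) (hab : b ≤ a)
    (h : Real.log a - Real.log b ≤ ρ) :
    (a - b) * (Real.log a - Real.log b) ≤ (4 + ρ) * (√a - √b) ^ 2 := by
  have ha : 0 < a := hb.trans_le hab
  obtain ⟨u, hu, rfl⟩ : ∃ u, 0 < u ∧ a = u ^ 2 := ⟨√a, by positivity, (Real.sq_sqrt ha.le).symm⟩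
  obtain ⟨v, hv, rfl⟩ : ∃ v, 0 < v ∧ b = v ^ 2 := ⟨√b, by positivity, (Real.sq_sqrt hb.le).symm⟩
  have huv : v ≤ u := (sq_le_sq₀ hv.le hu.le).1 hab
  rw [Real.sqrt_sq hu.le, Real.sqrt_sq hv.le, Real.log_pow, Real.log_pow] at *
  push_cast at *
  set ℓ := Real.log u - Real.log v with hℓ
  have e1 : 2 * Real.log u - 2 * Real.log v = 2 * ℓ := by rw [hℓ]; ring
  rw [e1] at h ⊢
  have h2 : 2 * ℓ * (u - v) ^ 2 ≤ ρ * (u - v) ^ 2 := by gcongr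
  have h1 : v * ℓ ≤ u - v := by
    have := Real.log_le_sub_one_of_pos (div_pos hu hv)
    rw [Real.log_div hu.ne' hv.ne', ← hℓ, le_sub_iff_add_le, le_div_iff₀ hv] at this
    linarith
  have h3 : 0 ≤ (u - v) * (u - v - v * ℓ) := mul_nonneg (by linarith) (by linarith)
  nlinarith

/-- The integrand of the modified log-Sobolev inequality is comparable to that of the log-Sobolev
inequality, at the price of the logarithm of the ratio of the two values. -/
theorem sub_mul_log_sub_le {a b ρ : ℝ} (ha : 0 < a) (hb : 0 < b)
    (h : Real.log a - Real.log b ≤ ρ) (h' : Real.log b - Real.log a ≤ ρ) :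
    (a - b) * (Real.log a - Real.log b) ≤ (4 + ρ) * (√a - √b) ^ 2 := by
  rcases le_total b a with hab | hab
  · exact sub_mul_log_sub_le_of_le hb hab h
  · have := sub_mul_log_sub_le_of_le ha hab h'
    linarith [sub_sq_comm (√a) (√b)]

/-- Joint convexity and homogeneity of `(a, b) ↦ (√a - √b)²`. -/
theorem sq_sqrt_sum_sub_sqrt_sum_le {ι : Type*} (s : Finset ι) (u v : ι → ℝ)
    (hu : ∀ i ∈ s, 0 ≤ u i) (hv : ∀ i ∈ s, 0 ≤ v i) :
    (√(∑ i ∈ s, u i) - √(∑ i ∈ s, v i)) ^ 2 ≤ ∑ i ∈ s, (√(u i) - √(v i)) ^ 2 := by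
  have hU := Finset.sum_nonneg hu
  have hV := Finset.sum_nonneg hv
  have hcs := Finset.sum_mul_sq_le_sq_mul_sq s (fun i => √(u i)) (fun i => √(v i))
  have e1 : ∑ i ∈ s, √(u i) ^ 2 = ∑ i ∈ s, u i :=
    Finset.sum_congr rfl fun i hi => Real.sq_sqrt (hu i hi)
  have e2 : ∑ i ∈ s, √(v i) ^ 2 = ∑ i ∈ s, v i :=
    Finset.sum_congr rfl fun i hi => Real.sq_sqrt (hv i hi)
  simp only [e1, e2] at hcs
  have h1 : ∑ i ∈ s, √(u i) * √(v i) ≤ √(∑ i ∈ s, u i) * √(∑ i ∈ s, v i) := by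
    rw [← Real.sqrt_mul hU]
    exact Real.le_sqrt_of_sq_le hcs
  have h2 : ∑ i ∈ s, (√(u i) - √(v i)) ^ 2
      = ∑ i ∈ s, u i + ∑ i ∈ s, v i - 2 * ∑ i ∈ s, √(u i) * √(v i) := by
    rw [← e1, ← e2, Finset.mul_sum, ← Finset.sum_add_distrib, ← Finset.sum_sub_distrib]
    exact Finset.sum_congr rfl fun i _ => by ring
  rw [h2, sub_sq, Real.sq_sqrt hU, Real.sq_sqrt hV]
  linarith

/-- Weighted form of `sq_sqrt_sum_sub_sqrt_sum_le`. -/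
theorem sq_sqrt_sum_mul_sub_sqrt_sum_mul_le {ι : Type*} (s : Finset ι) (c u v : ι → ℝ)
    (hc : ∀ i ∈ s, 0 ≤ c i) (hu : ∀ i ∈ s, 0 ≤ u i) (hv : ∀ i ∈ s, 0 ≤ v i) :
    (√(∑ i ∈ s, c i * u i) - √(∑ i ∈ s, c i * v i)) ^ 2
      ≤ ∑ i ∈ s, c i * (√(u i) - √(v i)) ^ 2 := by
  refine (sq_sqrt_sum_sub_sqrt_sum_le s _ _ (fun i hi => mul_nonneg (hc i hi) (hu i hi))
    fun i hi => mul_nonneg (hc i hi) (hv i hi)).trans_eq (Finset.sum_congr rfl fun i hi => ?_)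
  rw [Real.sqrt_mul (hc i hi), Real.sqrt_mul (hc i hi), ← mul_sub, mul_pow,
    Real.sq_sqrt (hc i hi)]

/-! ### Entropy of a weight on a finite set -/

/-- The entropy `∑ p f log f - A log (A / Z)`, where `A = ∑ p f` and `Z = ∑ p`, of a positive
function `f` with respect to a weight `p` on a finset `s` that need not have total mass one. -/
noncomputable def weightedEntropy {α : Type*} (s : Finset α) (p f : α → ℝ) : ℝ :=
  ∑ x ∈ s, p x * (f x * Real.log (f x))
    - (∑ x ∈ s, p x * f x) * Real.log ((∑ x ∈ s, p x * f x) / ∑ x ∈ s, p x)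

theorem weightedEntropy_congr {α : Type*} {s : Finset α} {p p' f f' : α → ℝ}
    (hp : ∀ x ∈ s, p x = p' x) (hf : ∀ x ∈ s, f x = f' x) :
    weightedEntropy s p f = weightedEntropy s p' f' := by
  have h1 : ∑ x ∈ s, p x * (f x * Real.log (f x)) = ∑ x ∈ s, p' x * (f' x * Real.log (f' x)) :=
    Finset.sum_congr rfl fun x hx => by rw [hp x hx, hf x hx]
  have h2 : ∑ x ∈ s, p x * f x = ∑ x ∈ s, p' x * f' x :=
    Finset.sum_congr rfl fun x hx => by rw [hp x hx, hf x hx]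
  unfold weightedEntropy
  rw [h1, h2, Finset.sum_congr rfl hp]

theorem weightedEntropy_singleton {α : Type*} (x : α) {p f : α → ℝ} (hp : p x ≠ 0) :
    weightedEntropy {x} p f = 0 := by
  simp only [weightedEntropy, Finset.sum_singleton, mul_div_cancel_left₀ _ hp]
  ring

/-- One half of the variational characterization of the entropy. -/
theorem weightedEntropy_le {α : Type*} {s : Finset α} (hs : s.Nonempty) {p f : α → ℝ}
    (hp : ∀ x ∈ s, 0 < p x) (hf : ∀ x ∈ s, 0 < f x) {c : ℝ} (hc : 0 < c) :
    weightedEntropy s p f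
      ≤ ∑ x ∈ s, p x * (f x * (Real.log (f x) - Real.log c) - f x + c) := by
  have hZ : 0 < ∑ x ∈ s, p x := Finset.sum_pos hp hs
  have hA : 0 < ∑ x ∈ s, p x * f x := Finset.sum_pos (fun x hx => mul_pos (hp x hx) (hf x hx)) hs
  unfold weightedEntropy
  set Z := ∑ x ∈ s, p x
  set A := ∑ x ∈ s, p x * f x
  have e : ∑ x ∈ s, p x * (f x * (Real.log (f x) - Real.log c) - f x + c)
      = ∑ x ∈ s, p x * (f x * Real.log (f x)) - Real.log c * A - A + c * Z := by
    simp only [A, Z, Finset.mul_sum, ← Finset.sum_add_distrib, ← Finset.sum_sub_distrib]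
    exact Finset.sum_congr rfl fun x _ => by ring
  rw [e]
  have h := Real.log_le_sub_one_of_pos (div_pos (mul_pos hc hZ) hA)
  rw [Real.log_div (by positivity) hA.ne', Real.log_mul hc.ne' hZ.ne'] at h
  rw [Real.log_div hA.ne' hZ.ne']
  have h2 : A * (Real.log c + Real.log Z - Real.log A) ≤ A * (c * Z / A - 1) := by gcongr
  have h3 : A * (c * Z / A - 1) = c * Z - A := by field_simp
  linarith

/-! ### Birth-death chains with monotone rates: the resolvent -/

/-- The rates `b` (births) and `d` (deaths) of a birth-death chain on `{0, …, m}`, reversible with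
respect to the positive weight `p`, whose birth rates are nonincreasing and whose death rates have
increments at least `δ`. -/
structure IsMonotoneBirthDeath (m : ℕ) (δ : ℝ) (p b d : ℕ → ℝ) : Prop where
  gap_pos : 0 < δ
  weight_pos : ∀ k ≤ m, 0 < p k
  birth_pos : ∀ k < m, 0 < b k
  birth_last : b m = 0
  birth_anti : ∀ k < m, b (k + 1) ≤ b k
  death_zero : d 0 = 0
  death_gap : ∀ k < m, δ ≤ d (k + 1) - d k
  balance : ∀ k < m, p k * b k = p (k + 1) * d (k + 1)

namespace IsMonotoneBirthDeath

/-- The generator of the birth-death chain. The truncated subtraction at `k = 0` is harmless because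
`d 0 = 0`. -/
noncomputable def gen (b d : ℕ → ℝ) (g : ℕ → ℝ) (k : ℕ) : ℝ :=
  b k * (g (k + 1) - g k) + d k * (g (k - 1) - g k)

/-- The Dirichlet form of the chain evaluated at `(√f, √f)`. -/
noncomputable def energy (m : ℕ) (p b f : ℕ → ℝ) : ℝ :=
  ∑ k ∈ Finset.range m, p k * b k * (√(f (k + 1)) - √(f k)) ^ 2

variable {m : ℕ} {δ : ℝ} {p b d : ℕ → ℝ}

theorem birth_nonneg (h : IsMonotoneBirthDeath m δ p b d) {k : ℕ} (hk : k ≤ m) : 0 ≤ b k := by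
  rcases hk.lt_or_eq with hk | rfl
  · exact (h.birth_pos k hk).le
  · exact h.birth_last.ge

theorem death_nonneg (h : IsMonotoneBirthDeath m δ p b d) {k : ℕ} (hk : k ≤ m) : 0 ≤ d k := by
  induction k with
  | zero => exact h.death_zero.ge
  | succ k ih => linarith [ih (by omega), h.death_gap k (by omega), h.gap_pos]

theorem energy_nonneg (h : IsMonotoneBirthDeath m δ p b d) (f : ℕ → ℝ) : 0 ≤ energy m p b f := by
  refine Finset.sum_nonneg fun k hk => ?_
  have hk := Finset.mem_range.1 hk
  have := h.weight_pos k hk.le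
  have := h.birth_pos k hk
  positivity

/-- Summation by parts. -/
theorem sum_mul_gen (h : IsMonotoneBirthDeath m δ p b d) (f g : ℕ → ℝ) :
    ∑ k ∈ Finset.range (m + 1), p k * (f k * gen b d g k)
      = -∑ k ∈ Finset.range m, p k * b k * ((f (k + 1) - f k) * (g (k + 1) - g k)) := by
  have e : ∀ k, p k * (f k * gen b d g k)
      = p k * (f k * (b k * (g (k + 1) - g k))) + p k * (f k * (d k * (g (k - 1) - g k))) := by
    intro k; unfold gen; ring
  simp only [e]
  rw [Finset.sum_add_distrib, Finset.sum_range_succ, Finset.sum_range_succ' _ m, h.birth_last,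
    h.death_zero]
  simp only [zero_mul, mul_zero, add_zero]
  rw [← Finset.sum_add_distrib, ← Finset.sum_neg_distrib]
  refine Finset.sum_congr rfl fun k hk => ?_
  have hb := h.balance k (Finset.mem_range.1 hk)
  rw [Nat.add_sub_cancel]
  linear_combination (f (k + 1) * (g (k + 1) - g k)) * hb

/-- The maximum principle for `δ - gen`. -/
theorem le_of_sub_gen_le (h : IsMonotoneBirthDeath m δ p b d) {g : ℕ → ℝ} {M : ℝ}
    (hg : ∀ k ≤ m, δ * g k - gen b d g k ≤ δ * M) {k : ℕ} (hk : k ≤ m) : g k ≤ M := by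
  obtain ⟨a, ha, hmax⟩ := Finset.exists_max_image (Finset.range (m + 1)) g ⟨0, by simp⟩
  simp only [Finset.mem_range, Nat.lt_succ_iff] at ha hmax
  have h1 : b a * (g (a + 1) - g a) ≤ 0 := by
    rcases ha.lt_or_eq with ha' | rfl
    · exact mul_nonpos_of_nonneg_of_nonpos (h.birth_nonneg ha) (by linarith [hmax (a + 1) ha'])
    · simp [h.birth_last]
  have h2 : d a * (g (a - 1) - g a) ≤ 0 :=
    mul_nonpos_of_nonneg_of_nonpos (h.death_nonneg ha) (by linarith [hmax (a - 1) (by omega)])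
  have h3 : δ * g a ≤ δ * M := by
    have := hg a ha
    unfold gen at this
    linarith
  exact (hmax k hk).trans (le_of_mul_le_mul_left h3 h.gap_pos)

theorem gen_neg (g : ℕ → ℝ) (k : ℕ) : gen b d (fun i => -g i) k = -gen b d g k := by
  unfold gen; ring

theorem ge_of_le_sub_gen (h : IsMonotoneBirthDeath m δ p b d) {g : ℕ → ℝ} {M : ℝ}
    (hg : ∀ k ≤ m, δ * M ≤ δ * g k - gen b d g k) {k : ℕ} (hk : k ≤ m) : M ≤ g k := by
  have := h.le_of_sub_gen_le (g := fun i => -g i) (M := -M)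
    (fun j hj => by rw [gen_neg]; linarith [hg j hj]) hk
  linarith

/-- `g` is the image of `f` under the resolvent `δ (δ - gen)⁻¹` on `{0, …, m}`, continued by `f`
outside. -/
structure IsResolvent (m : ℕ) (δ : ℝ) (b d f g : ℕ → ℝ) : Prop where
  eq : ∀ k ≤ m, δ * g k = δ * f k + gen b d g k
  eq_outside : ∀ k, m < k → g k = f k

theorem gen_congr (h : IsMonotoneBirthDeath m δ p b d) {g g' : ℕ → ℝ}
    (hg : ∀ k ≤ m, g k = g' k) {k : ℕ} (hk : k ≤ m) : gen b d g k = gen b d g' k := by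
  unfold gen
  rw [hg k hk, hg (k - 1) (by omega)]
  rcases hk.lt_or_eq with hk | rfl
  · rw [hg (k + 1) hk]
  · rw [h.birth_last, zero_mul, zero_mul]

theorem exists_isResolvent (h : IsMonotoneBirthDeath m δ p b d) (f : ℕ → ℝ) :
    ∃ g, IsResolvent m δ b d f g := by
  let e : (Fin (m + 1) → ℝ) → ℕ → ℝ := fun v k => if hk : k < m + 1 then v ⟨k, hk⟩ else 0
  have e_add : ∀ u v k, e (u + v) k = e u k + e v k := by
    intro u v k; simp only [e]; split_ifs <;> simp
  have e_smul : ∀ (a : ℝ) v k, e (a • v) k = a * e v k := by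
    intro u v k; simp only [e]; split_ifs <;> simp
  let A : (Fin (m + 1) → ℝ) →ₗ[ℝ] (Fin (m + 1) → ℝ) :=
    { toFun := fun v i => δ * e v i - gen b d (e v) i
      map_add' := fun u v => by
        ext i; simp only [gen, e_add, Pi.add_apply]; ring
      map_smul' := fun a v => by
        ext i; simp only [gen, e_smul, Pi.smul_apply, smul_eq_mul, RingHom.id_apply]; ring }
  have hinj : Function.Injective A := by
    rw [injective_iff_map_eq_zero]
    intro v hv
    have hv' : ∀ k ≤ m, δ * e v k - gen b d (e v) k = 0 := fun k hk =>
      congrFun hv ⟨k, Nat.lt_succ_of_le hk⟩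
    ext i
    have hi : (i : ℕ) ≤ m := Nat.lt_succ_iff.1 i.2
    have h1 := h.le_of_sub_gen_le (g := e v) (M := 0)
      (fun k hk => by rw [hv' k hk]; simp) hi
    have h2 := h.ge_of_le_sub_gen (g := e v) (M := 0)
      (fun k hk => by rw [hv' k hk]; simp) hi
    have h3 : e v i = v i := dif_pos i.2
    rw [← h3]
    exact le_antisymm h1 h2
  obtain ⟨v, hv⟩ := (LinearMap.injective_iff_surjective.1 hinj) fun i => δ * f i
  refine ⟨fun k => if k ≤ m then e v k else f k, fun k hk => ?_, fun k hk => ?_⟩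
  · rw [h.gen_congr (g' := e v) (fun j hj => if_pos hj) hk, if_pos hk]
    have : δ * e v k - gen b d (e v) k = δ * f k := congrFun hv ⟨k, Nat.lt_succ_of_le hk⟩
    linarith
  · exact if_neg (not_le.2 hk)

theorem IsResolvent.ge (h : IsMonotoneBirthDeath m δ p b d) {f g : ℕ → ℝ}
    (hg : IsResolvent m δ b d f g) {a : ℝ} (hf : ∀ k, a ≤ f k) (k : ℕ) : a ≤ g k := by
  rcases le_or_gt k m with hk | hk
  · refine h.ge_of_le_sub_gen (fun j hj => ?_) hk
    rw [hg.eq j hj]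
    linarith [mul_le_mul_of_nonneg_left (hf j) h.gap_pos.le]
  · exact (hf k).trans_eq (hg.eq_outside k hk).symm

theorem IsResolvent.le (h : IsMonotoneBirthDeath m δ p b d) {f g : ℕ → ℝ}
    (hg : IsResolvent m δ b d f g) {a : ℝ} (hf : ∀ k, f k ≤ a) (k : ℕ) : g k ≤ a := by
  rcases le_or_gt k m with hk | hk
  · refine h.le_of_sub_gen_le (fun j hj => ?_) hk
    rw [hg.eq j hj]
    linarith [mul_le_mul_of_nonneg_left (hf j) h.gap_pos.le]
  · exact (hg.eq_outside k hk).trans_le (hf k)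

theorem IsResolvent.sum_eq (h : IsMonotoneBirthDeath m δ p b d) {f g : ℕ → ℝ}
    (hg : IsResolvent m δ b d f g) :
    ∑ k ∈ Finset.range (m + 1), p k * g k = ∑ k ∈ Finset.range (m + 1), p k * f k := by
  have h1 := h.sum_mul_gen (fun _ => 1) g
  simp only [sub_self, zero_mul, mul_zero, Finset.sum_const_zero, neg_zero, one_mul] at h1
  have h2 : δ * ∑ k ∈ Finset.range (m + 1), p k * g k
      = δ * ∑ k ∈ Finset.range (m + 1), p k * f k
        + ∑ k ∈ Finset.range (m + 1), p k * gen b d g k := by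
    rw [Finset.mul_sum, Finset.mul_sum, ← Finset.sum_add_distrib]
    refine Finset.sum_congr rfl fun k hk => ?_
    have := hg.eq k (Nat.lt_succ_iff.1 (Finset.mem_range.1 hk))
    linear_combination p k * this
  rw [h1, add_zero] at h2
  exact mul_left_cancel₀ h.gap_pos.ne' h2

/-- Contraction of the energy under the resolvent. Two copies of the chain started from neighbouring
states move together, except that they merge at rate
`(b k - b (k + 1)) + (d (k + 1) - d k) ≥ δ`. -/
theorem IsResolvent.energy_le (h : IsMonotoneBirthDeath m δ p b d) {f g : ℕ → ℝ}
    (hg : IsResolvent m δ b d f g) (hf0 : ∀ k, 0 < f k) (hg0 : ∀ k, 0 < g k) :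
    2 * energy m p b g ≤ energy m p b f := by
  let φ : ℕ → ℝ := fun k => (√(g (k + 1)) - √(g k)) ^ 2
  let ψ : ℕ → ℝ := fun k => (√(f (k + 1)) - √(f k)) ^ 2
  have hδ := h.gap_pos
  have key : ∀ k < m, (δ + b k + d (k + 1)) * φ k
      ≤ δ * ψ k + b (k + 1) * φ (k + 1) + d k * φ (k - 1) := by
    intro k hk
    have hb := h.birth_nonneg hk.le
    have hb' := h.birth_nonneg (k := k + 1) hk
    have hd := h.death_nonneg hk.le
    have hd' := h.death_nonneg (k := k + 1) hk
    have hba := h.birth_anti k hk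
    have hda := h.death_gap k hk
    set e : ℝ := (b k - b (k + 1)) * g (k + 1) + (d (k + 1) - d k) * g k with he
    have he0 : 0 ≤ e := add_nonneg (mul_nonneg (by linarith) (hg0 _).le)
      (mul_nonneg (by linarith) (hg0 _).le)
    -- The four terms stand for the source term of the resolvent equation, a joint birth, a joint
    -- death, and the jumps after which the two copies have merged.
    have hsub := sq_sqrt_sum_mul_sub_sqrt_sum_mul_le (Finset.univ : Finset (Fin 4))
      ![δ, b (k + 1), d k, 1] ![f (k + 1), g (k + 2), g k, e] ![f k, g (k + 1), g (k - 1), e]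
      (by intro i _; fin_cases i <;> simp [hδ.le, hb', hd])
      (by intro i _; fin_cases i <;> simp [(hf0 _).le, (hg0 _).le, he0])
      (by intro i _; fin_cases i <;> simp [(hf0 _).le, (hg0 _).le, he0])
    simp only [Fin.sum_univ_four, Matrix.cons_val] at hsub
    have e1 := hg.eq (k + 1) hk
    have e2 := hg.eq k hk.le
    unfold gen at e1 e2
    rw [Nat.add_sub_cancel] at e1
    have e3 : δ * f (k + 1) + b (k + 1) * g (k + 2) + d k * g k + 1 * e
        = (δ + b k + d (k + 1)) * g (k + 1) := by rw [he]; linear_combination -e1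
    have e4 : δ * f k + b (k + 1) * g (k + 1) + d k * g (k - 1) + 1 * e
        = (δ + b k + d (k + 1)) * g k := by rw [he]; linear_combination -e2
    have hc : 0 ≤ δ + b k + d (k + 1) := by positivity
    rw [e3, e4, Real.sqrt_mul hc, Real.sqrt_mul hc, ← mul_sub, mul_pow, Real.sq_sqrt hc, sub_self,
      zero_pow two_ne_zero, mul_zero, add_zero] at hsub
    rcases Nat.eq_zero_or_pos k with rfl | hk0
    · simpa [φ, ψ, h.death_zero] using hsub
    · have : k - 1 + 1 = k := Nat.sub_add_cancel hk0
      simpa only [φ, ψ, this] using hsub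
  have hsum : ∑ k ∈ Finset.range m, p k * b k * ((δ + b k + d (k + 1)) * φ k)
      ≤ ∑ k ∈ Finset.range m, p k * b k * (δ * ψ k + b (k + 1) * φ (k + 1) + d k * φ (k - 1)) :=
    Finset.sum_le_sum fun k hk => by
      have hk := Finset.mem_range.1 hk
      exact mul_le_mul_of_nonneg_left (key k hk)
        (mul_nonneg (h.weight_pos k hk.le).le (h.birth_pos k hk).le)
  -- The edge weights `p k * b k` are reversible for the pair of chains started from an edge.
  have hshift : ∀ j, j ≤ m → ∑ k ∈ Finset.range j, p k * b k * (b (k + 1) * φ (k + 1))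
      = ∑ k ∈ Finset.range j, p k * b k * (d k * φ k)
        + p j * b j * (d j * φ j) := by
    intro j hj
    induction j with
    | zero => simp [h.death_zero]
    | succ j ih =>
      rw [Finset.sum_range_succ, Finset.sum_range_succ, ih (by omega)]
      have := h.balance j hj
      linear_combination (b (j + 1) * φ (j + 1)) * this
  have hshift' : ∀ j, j ≤ m → ∑ k ∈ Finset.range j, p k * b k * (d k * φ (k - 1))
      + p j * b j * (d j * φ (j - 1)) = ∑ k ∈ Finset.range j, p k * b k * (b (k + 1) * φ k) := by
    intro j hj
    induction j with
    | zero => simp [h.death_zero]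
    | succ j ih =>
      rw [Finset.sum_range_succ, Finset.sum_range_succ, ih (by omega), Nat.add_sub_cancel]
      have := h.balance j hj
      linear_combination -(b (j + 1) * φ j) * this
  have s1 := hshift m le_rfl
  have s2 := hshift' m le_rfl
  rw [h.birth_last, mul_zero, zero_mul, add_zero] at s1 s2
  simp only [mul_add, Finset.sum_add_distrib, s1, s2] at hsum
  have hmain : ∑ k ∈ Finset.range m, p k * b k * (2 * δ * φ k)
      ≤ ∑ k ∈ Finset.range m, p k * b k * ((δ + b k + d (k + 1)) * φ k)
        - ∑ k ∈ Finset.range m, p k * b k * (d k * φ k)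
        - ∑ k ∈ Finset.range m, p k * b k * (b (k + 1) * φ k) := by
    rw [← Finset.sum_sub_distrib, ← Finset.sum_sub_distrib]
    refine Finset.sum_le_sum fun k hk => ?_
    have hk := Finset.mem_range.1 hk
    have hba := h.birth_anti k hk
    have hda := h.death_gap k hk
    have h0 : 0 ≤ p k * b k * φ k :=
      mul_nonneg (mul_nonneg (h.weight_pos k hk.le).le (h.birth_pos k hk).le) (sq_nonneg _)
    nlinarith
  simp only [mul_add, add_mul, Finset.sum_add_distrib] at hmain
  simp only [add_mul, mul_add, Finset.sum_add_distrib] at hsum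
  have e5 : ∑ k ∈ Finset.range m, p k * b k * (2 * δ * φ k) = δ * (2 * energy m p b g) := by
    rw [energy, Finset.mul_sum, Finset.mul_sum]
    exact Finset.sum_congr rfl fun k _ => by simp only [φ]; ring
  have e6 : ∑ k ∈ Finset.range m, p k * b k * (δ * ψ k) = δ * energy m p b f := by
    rw [energy, Finset.mul_sum]
    exact Finset.sum_congr rfl fun k _ => by simp only [ψ]; ring
  rw [e5] at hmain
  rw [e6] at hsum
  exact le_of_mul_le_mul_left (by linarith) hδ

end IsMonotoneBirthDeath

/-! ### Birth-death chains with monotone rates: the log-Sobolev inequality -/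

namespace IsMonotoneBirthDeath

variable {m : ℕ} {δ : ℝ} {p b d : ℕ → ℝ}

/-- The resolvent moves `√f` by at most the energy in mean square. The pointwise bound behind it is
`√f ≤ √g - gen √g / δ`, which comes from `gen g ≥ 2 √g gen √g`. -/
theorem IsResolvent.sum_sq_sqrt_sub_le (h : IsMonotoneBirthDeath m δ p b d) {f g : ℕ → ℝ}
    (hg : IsResolvent m δ b d f g) (hf0 : ∀ k, 0 < f k) (hg0 : ∀ k, 0 < g k) :
    δ * ∑ k ∈ Finset.range (m + 1), p k * (√(f k) - √(g k)) ^ 2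
      ≤ energy m p b f + energy m p b g := by
  have hδ := h.gap_pos
  set u : ℕ → ℝ := fun k => √(f k) with hu
  set v : ℕ → ℝ := fun k => √(g k) with hv
  have hu0 : ∀ k, 0 < u k := fun k => Real.sqrt_pos.2 (hf0 k)
  have hv0 : ∀ k, 0 < v k := fun k => Real.sqrt_pos.2 (hg0 k)
  have hu2 : ∀ k, u k ^ 2 = f k := fun k => Real.sq_sqrt (hf0 k).le
  have hv2 : ∀ k, v k ^ 2 = g k := fun k => Real.sq_sqrt (hg0 k).le
  have key : ∀ k ≤ m, δ * u k - δ * v k ≤ -gen b d v k := by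
    intro k hk
    have hb := h.birth_nonneg hk
    have hd := h.death_nonneg hk
    have e := hg.eq k hk
    have hL : 2 * v k * gen b d v k ≤ gen b d g k := by
      have h1 := mul_nonneg hb (sq_nonneg (v (k + 1) - v k))
      have h2 := mul_nonneg hd (sq_nonneg (v (k - 1) - v k))
      unfold gen
      rw [← hv2, ← hv2, ← hv2]
      nlinarith
    rw [← hu2, ← hv2] at e
    set ℓ := gen b d v k
    have h3 : δ * u k ^ 2 ≤ δ * v k ^ 2 - 2 * v k * ℓ := by linarith
    have h4 : (δ * u k) ^ 2 ≤ (δ * v k - ℓ) ^ 2 := by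
      have : δ * (δ * u k ^ 2) ≤ δ * (δ * v k ^ 2 - 2 * v k * ℓ) := by gcongr
      nlinarith [sq_nonneg ℓ]
    have h5 : 0 ≤ δ * v k - ℓ := by
      have h6 : 0 < v k * (δ * v k - 2 * ℓ) := by
        have := mul_pos hδ (pow_pos (hu0 k) 2)
        nlinarith
      have h7 := (mul_pos_iff_of_pos_left (hv0 k)).1 h6
      have h8 := mul_pos hδ (hv0 k)
      linarith
    linarith [abs_le_of_sq_le_sq h4 h5, le_abs_self (δ * u k)]
  have hmass := hg.sum_eq h
  have e1 : ∑ k ∈ Finset.range (m + 1), p k * (u k - v k) ^ 2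
      = 2 * ∑ k ∈ Finset.range (m + 1), p k * (u k * (u k - v k)) := by
    have : ∑ k ∈ Finset.range (m + 1), p k * (u k - v k) ^ 2
        - 2 * ∑ k ∈ Finset.range (m + 1), p k * (u k * (u k - v k))
        = ∑ k ∈ Finset.range (m + 1), p k * g k - ∑ k ∈ Finset.range (m + 1), p k * f k := by
      rw [Finset.mul_sum, ← Finset.sum_sub_distrib, ← Finset.sum_sub_distrib]
      refine Finset.sum_congr rfl fun k _ => ?_
      rw [← hu2, ← hv2]; ring
    linarith
  have e2 : δ * ∑ k ∈ Finset.range (m + 1), p k * (u k * (u k - v k))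
      ≤ -∑ k ∈ Finset.range (m + 1), p k * (u k * gen b d v k) := by
    rw [Finset.mul_sum, ← Finset.sum_neg_distrib]
    refine Finset.sum_le_sum fun k hk => ?_
    have hk := Nat.lt_succ_iff.1 (Finset.mem_range.1 hk)
    have := mul_le_mul_of_nonneg_left (key k hk) (mul_pos (h.weight_pos k hk) (hu0 k)).le
    linarith
  rw [h.sum_mul_gen, neg_neg] at e2
  have e3 : 2 * ∑ k ∈ Finset.range m, p k * b k * ((u (k + 1) - u k) * (v (k + 1) - v k))
      ≤ energy m p b f + energy m p b g := by
    rw [energy, energy, Finset.mul_sum, ← Finset.sum_add_distrib]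
    refine Finset.sum_le_sum fun k hk => ?_
    have hk := Finset.mem_range.1 hk
    have h0 : 0 ≤ p k * b k := mul_nonneg (h.weight_pos k hk.le).le (h.birth_pos k hk).le
    have := mul_nonneg h0 (sq_nonneg ((u (k + 1) - u k) - (v (k + 1) - v k)))
    simp only [hu, hv] at this ⊢
    linarith
  rw [e1]
  linarith

/-- The rates of the chain are comparable up to exponentials of `Λ`: the exit rate, increased by
`δ`, is at most `exp Λ` times `δ` and at most `exp (2 Λ)` times the rate of either jump. The lower
bound on `Λ` serves to absorb additive constants. -/
structure HasLogRatio (m : ℕ) (δ Λ : ℝ) (b d : ℕ → ℝ) : Prop where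
  two_thirds_le : 2 / 3 ≤ Λ
  exit_le : ∀ k ≤ m, δ + b k + d k ≤ Real.exp Λ * δ
  exit_le_birth : ∀ k < m, δ + b k + d k ≤ Real.exp (2 * Λ) * b k
  exit_le_death : ∀ k < m, δ + b (k + 1) + d (k + 1) ≤ Real.exp (2 * Λ) * d (k + 1)

theorem log_sub_log_le_of_le_exp_mul {x y ρ : ℝ} (hx : 0 < x) (hy : 0 < y)
    (hxy : x ≤ Real.exp ρ * y) : Real.log x - Real.log y ≤ ρ := by
  have := Real.log_le_log hx hxy
  rw [Real.log_mul (Real.exp_pos _).ne' hy.ne', Real.log_exp] at this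
  linarith

/-- Entropy dissipation over one step of the resolvent. The resolvent equation bounds the ratio of
the values of `g` at neighbouring states and the ratio `f / g`, so that all logarithms are under
control. -/
theorem IsResolvent.weightedEntropy_le (h : IsMonotoneBirthDeath m δ p b d) {Λ : ℝ}
    (hΛ : HasLogRatio m δ Λ b d) {f g : ℕ → ℝ}
    (hg : IsResolvent m δ b d f g) (hf0 : ∀ k, 0 < f k) (hg0 : ∀ k, 0 < g k) :
    weightedEntropy (Finset.range (m + 1)) p f
      ≤ weightedEntropy (Finset.range (m + 1)) p g + 10 * Λ / δ * energy m p b f := by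
  have hδ := h.gap_pos
  have hΛ0 := hΛ.two_thirds_le
  have hnn : ∀ k ≤ m, 0 ≤ b k * g (k + 1) ∧ 0 ≤ d k * g (k - 1) := fun k hk =>
    ⟨mul_nonneg (h.birth_nonneg hk) (hg0 _).le, mul_nonneg (h.death_nonneg hk) (hg0 _).le⟩
  have heq : ∀ k ≤ m, (δ + b k + d k) * g k = δ * f k + b k * g (k + 1) + d k * g (k - 1) := by
    intro k hk
    have := hg.eq k hk
    unfold gen at this
    linear_combination this
  have hfg : ∀ k ≤ m, Real.log (f k) - Real.log (g k) ≤ Λ := by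
    intro k hk
    refine log_sub_log_le_of_le_exp_mul (hf0 k) (hg0 k) (le_of_mul_le_mul_left ?_ hδ)
    have h1 := mul_le_mul_of_nonneg_right (hΛ.exit_le k hk) (hg0 k).le
    rw [heq k hk] at h1
    linarith [hnn k hk]
  have hup : ∀ k < m, Real.log (g (k + 1)) - Real.log (g k) ≤ 2 * Λ := by
    intro k hk
    refine log_sub_log_le_of_le_exp_mul (hg0 _) (hg0 _)
      (le_of_mul_le_mul_left ?_ (h.birth_pos k hk))
    have h1 := mul_le_mul_of_nonneg_right (hΛ.exit_le_birth k hk) (hg0 k).le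
    rw [heq k hk.le] at h1
    linarith [hnn k hk.le, mul_pos hδ (hf0 k)]
  have hdown : ∀ k < m, Real.log (g k) - Real.log (g (k + 1)) ≤ 2 * Λ := by
    intro k hk
    have hd : 0 < d (k + 1) := by linarith [h.death_nonneg hk.le, h.death_gap k hk]
    refine log_sub_log_le_of_le_exp_mul (hg0 _) (hg0 _) (le_of_mul_le_mul_left ?_ hd)
    have h1 := mul_le_mul_of_nonneg_right (hΛ.exit_le_death k hk) (hg0 (k + 1)).le
    rw [heq (k + 1) hk, Nat.add_sub_cancel] at h1
    linarith [hnn (k + 1) hk, mul_pos hδ (hf0 (k + 1))]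
  have hmass := hg.sum_eq h
  have hcontr := hg.energy_le h hf0 hg0
  have hsq := hg.sum_sq_sqrt_sub_le h hf0 hg0
  -- `f log f - g log g = (f log (f / g) - f + g) + (f - g) log g` in mean, because `f` and `g` have
  -- the same mean, and `f - g = -gen g / δ`.
  have hsplit : δ * weightedEntropy (Finset.range (m + 1)) p f
      - δ * weightedEntropy (Finset.range (m + 1)) p g
      = δ * ∑ k ∈ Finset.range (m + 1),
          p k * (f k * (Real.log (f k) - Real.log (g k)) - f k + g k)
        - ∑ k ∈ Finset.range (m + 1), p k * (Real.log (g k) * gen b d g k) := by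
    unfold weightedEntropy
    rw [hmass]
    have : ∑ k ∈ Finset.range (m + 1),
          p k * (f k * (Real.log (f k) - Real.log (g k)) - f k + g k)
        = ∑ k ∈ Finset.range (m + 1), p k * (f k * (Real.log (f k) - Real.log (g k))) := by
      have : ∑ k ∈ Finset.range (m + 1),
          p k * (f k * (Real.log (f k) - Real.log (g k)) - f k + g k)
        = ∑ k ∈ Finset.range (m + 1), p k * (f k * (Real.log (f k) - Real.log (g k)))
          + (∑ k ∈ Finset.range (m + 1), p k * g k
            - ∑ k ∈ Finset.range (m + 1), p k * f k) := by
        rw [← Finset.sum_sub_distrib, ← Finset.sum_add_distrib]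
        exact Finset.sum_congr rfl fun k _ => by ring
      rw [this, hmass, sub_self, add_zero]
    rw [this, ← mul_sub, sub_sub_sub_cancel_right, Finset.mul_sum, ← Finset.sum_sub_distrib,
      ← Finset.sum_sub_distrib, Finset.mul_sum]
    refine Finset.sum_congr rfl fun k hk => ?_
    have := hg.eq k (Nat.lt_succ_iff.1 (Finset.mem_range.1 hk))
    linear_combination (-p k * Real.log (g k)) * this
  rw [h.sum_mul_gen, sub_neg_eq_add] at hsplit
  have h1 : ∑ k ∈ Finset.range (m + 1), p k * (f k * (Real.log (f k) - Real.log (g k)) - f k + g k)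
      ≤ (2 + Λ) * ∑ k ∈ Finset.range (m + 1), p k * (√(f k) - √(g k)) ^ 2 := by
    rw [Finset.mul_sum]
    refine Finset.sum_le_sum fun k hk => ?_
    have hk := Nat.lt_succ_iff.1 (Finset.mem_range.1 hk)
    have := mul_le_mul_of_nonneg_left
      (relEntropy_le_sq_sqrt_sub (hf0 k) (hg0 k) (by linarith) (hfg k hk)) (h.weight_pos k hk).le
    linarith
  have h2 : ∑ k ∈ Finset.range m,
        p k * b k * ((Real.log (g (k + 1)) - Real.log (g k)) * (g (k + 1) - g k))
      ≤ (4 + 2 * Λ) * energy m p b g := by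
    rw [energy, Finset.mul_sum]
    refine Finset.sum_le_sum fun k hk => ?_
    have hk := Finset.mem_range.1 hk
    have := mul_le_mul_of_nonneg_left
      (sub_mul_log_sub_le (hg0 (k + 1)) (hg0 k) (hup k hk) (hdown k hk))
      (mul_pos (h.weight_pos k hk.le) (h.birth_pos k hk)).le
    linarith
  have hE := h.energy_nonneg f
  have h3 : δ * weightedEntropy (Finset.range (m + 1)) p f
      ≤ δ * weightedEntropy (Finset.range (m + 1)) p g + 10 * Λ * energy m p b f := by
    have h4 := mul_le_mul_of_nonneg_left h1 hδ.le
    have h5 := mul_le_mul_of_nonneg_left hsq (by linarith : 0 ≤ 2 + Λ)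
    have h6 := mul_le_mul_of_nonneg_left hcontr (by linarith : 0 ≤ 2 + Λ)
    have h7 := mul_le_mul_of_nonneg_left hcontr (by linarith : 0 ≤ 4 + 2 * Λ)
    have h8 := mul_le_mul_of_nonneg_right hΛ0 hE
    linarith
  refine le_of_mul_le_mul_left ?_ hδ
  have e : δ * (10 * Λ / δ * energy m p b f) = 10 * Λ * energy m p b f := by field_simp
  rw [mul_add, e]
  exact h3

/-- A log-Sobolev inequality whose constant may depend on the range of `f`. -/
theorem exists_weightedEntropy_le (h : IsMonotoneBirthDeath m δ p b d) {lo hi : ℝ} (hlo : 0 < lo) :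
    ∃ C, 0 ≤ C ∧ ∀ f : ℕ → ℝ, (∀ k, lo ≤ f k) → (∀ k, f k ≤ hi) →
      weightedEntropy (Finset.range (m + 1)) p f ≤ C * energy m p b f := by
  obtain ⟨c, hc, hcp⟩ : ∃ c, 0 < c ∧ ∀ k < m, c ≤ p k * b k := by
    rcases Nat.eq_zero_or_pos m with rfl | hm
    · exact ⟨1, one_pos, fun k hk => absurd hk (Nat.not_lt_zero k)⟩
    · obtain ⟨a, ha, hmin⟩ := Finset.exists_min_image (Finset.range m) (fun k => p k * b k)
        ⟨0, by simpa using hm⟩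
      have ha := Finset.mem_range.1 ha
      exact ⟨p a * b a, mul_pos (h.weight_pos a ha.le) (h.birth_pos a ha),
        fun k hk => hmin k (Finset.mem_range.2 hk)⟩
  have hp : ∀ k ∈ Finset.range (m + 1), 0 < p k := fun k hk =>
    h.weight_pos k (Nat.lt_succ_iff.1 (Finset.mem_range.1 hk))
  set P := ∑ k ∈ Finset.range (m + 1), p k with hP
  have hP0 : 0 ≤ P := Finset.sum_nonneg fun k hk => (hp k hk).le
  rcases lt_or_ge hi lo with hlt | hle
  · exact ⟨0, le_rfl, fun f h1 h2 => absurd ((h1 0).trans (h2 0)) (not_le.2 hlt)⟩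
  have hhi : 0 < hi := hlo.trans_le hle
  refine ⟨P * (m * (4 * hi / c) / lo), by positivity, fun f hf1 hf2 => ?_⟩
  have hf0 : ∀ k, 0 < f k := fun k => hlo.trans_le (hf1 k)
  have hE := h.energy_nonneg f
  have hvar : ∀ k ≤ m, (f k - f 0) ^ 2 ≤ m * (4 * hi / c * energy m p b f) := by
    intro k hk
    rw [← Finset.sum_range_sub f k]
    have h1 := sq_sum_le_card_mul_sum_sq (s := Finset.range k) (f := fun i => f (i + 1) - f i)
    rw [Finset.card_range] at h1
    have h2 : ∑ i ∈ Finset.range k, (f (i + 1) - f i) ^ 2 ≤ 4 * hi / c * energy m p b f := by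
      refine (Finset.sum_le_sum_of_subset_of_nonneg (Finset.range_mono hk)
        fun i _ _ => sq_nonneg _).trans ?_
      rw [energy, Finset.mul_sum]
      refine Finset.sum_le_sum fun i hi' => ?_
      have hi' := Finset.mem_range.1 hi'
      set x := √(f (i + 1)) with hx
      set y := √(f i) with hy
      have ex : f (i + 1) = x ^ 2 := (Real.sq_sqrt (hf0 _).le).symm
      have ey : f i = y ^ 2 := (Real.sq_sqrt (hf0 _).le).symm
      have h3 : (x + y) ^ 2 ≤ 4 * hi := by
        have h4 := hf2 (i + 1)
        have h5 := hf2 i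
        rw [ex] at h4
        rw [ey] at h5
        nlinarith [sq_nonneg (x - y)]
      have h6 : (1 : ℝ) ≤ p i * b i / c := (one_le_div hc).2 (hcp i hi')
      rw [ex, ey]
      calc (x ^ 2 - y ^ 2) ^ 2 = (x + y) ^ 2 * (x - y) ^ 2 := by ring
        _ ≤ 4 * hi * (x - y) ^ 2 := by gcongr
        _ = 4 * hi * (x - y) ^ 2 * 1 := (mul_one _).symm
        _ ≤ 4 * hi * (x - y) ^ 2 * (p i * b i / c) := by gcongr
        _ = 4 * hi / c * (p i * b i * (x - y) ^ 2) := by ring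
    have h3 : (k : ℝ) ≤ m := by exact_mod_cast hk
    have h4 : (0 : ℝ) ≤ ∑ i ∈ Finset.range k, (f (i + 1) - f i) ^ 2 :=
      Finset.sum_nonneg fun i _ => sq_nonneg _
    calc _ ≤ (k : ℝ) * ∑ i ∈ Finset.range k, (f (i + 1) - f i) ^ 2 := h1
      _ ≤ _ := by gcongr
  refine (_root_.weightedEntropy_le ⟨0, by simp⟩ hp (fun k _ => hf0 k) (hf0 0)).trans ?_
  have hpt : ∀ k ∈ Finset.range (m + 1),
      p k * (f k * (Real.log (f k) - Real.log (f 0)) - f k + f 0)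
        ≤ p k * (m * (4 * hi / c * energy m p b f) / lo) := by
    intro k hk
    refine mul_le_mul_of_nonneg_left ?_ (hp k hk).le
    have h1 := Real.log_le_sub_one_of_pos (div_pos (hf0 k) (hf0 0))
    rw [Real.log_div (hf0 k).ne' (hf0 0).ne'] at h1
    have h2 := mul_le_mul_of_nonneg_left h1 (hf0 k).le
    have h3 : f k * (f k / f 0 - 1) - f k + f 0 = (f k - f 0) ^ 2 / f 0 := by
      have := (hf0 0).ne'
      field_simp; ring
    have h4 := hvar k (Nat.lt_succ_iff.1 (Finset.mem_range.1 hk))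
    have h5 : (f k - f 0) ^ 2 / f 0 ≤ m * (4 * hi / c * energy m p b f) / lo := by
      gcongr
      exact hf1 0
    linarith
  refine (Finset.sum_le_sum hpt).trans_eq ?_
  rw [← Finset.sum_mul, ← hP]
  ring

/-- The log-Sobolev inequality for birth-death chains with monotone rates. The dissipation estimate
is summed along the iterates of the resolvent, whose energies decay geometrically. -/
theorem logSobolev (h : IsMonotoneBirthDeath m δ p b d) {Λ : ℝ}
    (hΛ : HasLogRatio m δ Λ b d) {f : ℕ → ℝ} (hf : ∀ k ≤ m, 0 < f k) :
    weightedEntropy (Finset.range (m + 1)) p f ≤ 20 * Λ / δ * energy m p b f := by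
  have hδ := h.gap_pos
  have hΛ0 := hΛ.two_thirds_le
  obtain ⟨f', hff', hf'⟩ : ∃ f' : ℕ → ℝ, (∀ k ≤ m, f k = f' k) ∧ ∃ lo hi, 0 < lo ∧
      ∀ k, lo ≤ f' k ∧ f' k ≤ hi := by
    obtain ⟨a, ha, hmin⟩ := Finset.exists_min_image (Finset.range (m + 1)) f ⟨0, by simp⟩
    obtain ⟨a', ha', hmax⟩ := Finset.exists_max_image (Finset.range (m + 1)) f ⟨0, by simp⟩
    simp only [Finset.mem_range, Nat.lt_succ_iff] at ha hmin ha' hmax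
    -- Only the values on `{0, …, m}` matter.
    refine ⟨fun k => f (min k m), fun k hk => by simp [hk], f a, f a', hf a ha, fun k => ?_⟩
    exact ⟨hmin _ (min_le_right _ _), hmax _ (min_le_right _ _)⟩
  have e1 : weightedEntropy (Finset.range (m + 1)) p f
      = weightedEntropy (Finset.range (m + 1)) p f' :=
    weightedEntropy_congr (fun _ _ => rfl) fun k hk =>
      hff' k (Nat.lt_succ_iff.1 (Finset.mem_range.1 hk))
  have e2 : energy m p b f = energy m p b f' := Finset.sum_congr rfl fun k hk => by
    have hk := Finset.mem_range.1 hk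
    rw [hff' k hk.le, hff' (k + 1) hk]
  rw [e1, e2]
  obtain ⟨lo, hi, hlo, hb⟩ := hf'
  obtain ⟨C, hC0, hC⟩ := h.exists_weightedEntropy_le (lo := lo) (hi := hi) hlo
  have hiter : ∀ N : ℕ, ∀ f : ℕ → ℝ, (∀ k, lo ≤ f k ∧ f k ≤ hi) →
      weightedEntropy (Finset.range (m + 1)) p f
        ≤ (20 * Λ / δ + (1 / 2) ^ N * C) * energy m p b f := by
    intro N
    induction N with
    | zero =>
      intro f hf
      refine (hC f (fun k => (hf k).1) fun k => (hf k).2).trans ?_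
      have := h.energy_nonneg f
      gcongr
      have : 0 ≤ 20 * Λ / δ := by positivity
      linarith
    | succ N ih =>
      intro f hf
      obtain ⟨g, hg⟩ := h.exists_isResolvent f
      have hg1 := hg.ge h fun k => (hf k).1
      have hg2 := hg.le h fun k => (hf k).2
      have hf0 : ∀ k, 0 < f k := fun k => hlo.trans_le (hf k).1
      have hg0 : ∀ k, 0 < g k := fun k => hlo.trans_le (hg1 k)
      have h1 := hg.weightedEntropy_le h hΛ hf0 hg0
      have h2 := ih g fun k => ⟨hg1 k, hg2 k⟩
      have h3 := hg.energy_le h hf0 hg0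
      have h4 : 0 ≤ 20 * Λ / δ + (1 / 2) ^ N * C := by positivity
      have h5 := mul_le_mul_of_nonneg_left h3 h4
      have h6 : 10 * Λ / δ = 20 * Λ / δ / 2 := by ring
      rw [h6] at h1
      rw [pow_succ]
      linarith
  have hlim : Filter.Tendsto (fun N : ℕ => (20 * Λ / δ + (1 / 2 : ℝ) ^ N * C) * energy m p b f')
      Filter.atTop (nhds ((20 * Λ / δ + 0 * C) * energy m p b f')) :=
    (((tendsto_pow_atTop_nhds_zero_of_lt_one (by norm_num) (by norm_num)).mul_const C).const_add
      _).mul_const _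
  rw [zero_mul, add_zero] at hlim
  exact ge_of_tendsto' hlim fun N => hiter N f' hb

end IsMonotoneBirthDeath

/-! ### Reversible weights and generator of the zero-range process -/

namespace ZeroRange

open Finset

variable {ι : Type*}

/-- Zero-range rate functions whose increments lie in `[δ, Δ]`. -/
structure IsRate (δ Δ : ℝ) (r : ι → ℕ → ℝ) : Prop where
  pos : 0 < δ
  zero : ∀ i, r i 0 = 0
  gap : ∀ i k, δ ≤ r i (k + 1) - r i k
  gap_le : ∀ i k, r i (k + 1) - r i k ≤ Δ

namespace IsRate

variable {δ Δ : ℝ} {r : ι → ℕ → ℝ}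

theorem mul_le (h : IsRate δ Δ r) (i : ι) (k : ℕ) : δ * k ≤ r i k := by
  induction k with
  | zero => simp [h.zero]
  | succ k ih => push_cast; linarith [h.gap i k]

theorem le_mul (h : IsRate δ Δ r) (i : ι) (k : ℕ) : r i k ≤ Δ * k := by
  induction k with
  | zero => simp [h.zero]
  | succ k ih => push_cast; linarith [h.gap_le i k]

theorem nonneg (h : IsRate δ Δ r) (i : ι) (k : ℕ) : 0 ≤ r i k :=
  (mul_nonneg h.pos.le k.cast_nonneg).trans (h.mul_le i k)

theorem succ_pos (h : IsRate δ Δ r) (i : ι) (k : ℕ) : 0 < r i (k + 1) := by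
  linarith [h.nonneg i k, h.gap i k, h.pos]

theorem monotone (h : IsRate δ Δ r) (i : ι) : Monotone (r i) :=
  monotone_nat_of_le_succ fun k => by linarith [h.gap i k, h.pos]

end IsRate

variable {δ Δ : ℝ} {r : ι → ℕ → ℝ} {S : Finset ι}

/-- The contribution `1 / (r i 1 ⋯ r i k)` of a site holding `k` particles to the reversible
weight. -/
noncomputable def siteWeight (r : ι → ℕ → ℝ) (i : ι) (k : ℕ) : ℝ :=
  ∏ j ∈ range k, (r i (j + 1))⁻¹

theorem siteWeight_pos (hr : IsRate δ Δ r) (i : ι) (k : ℕ) : 0 < siteWeight r i k :=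
  prod_pos fun j _ => inv_pos.2 (hr.succ_pos i j)

theorem siteWeight_succ_mul (hr : IsRate δ Δ r) (i : ι) (k : ℕ) :
    siteWeight r i (k + 1) * r i (k + 1) = siteWeight r i k := by
  rw [siteWeight, prod_range_succ, mul_assoc, inv_mul_cancel₀ (hr.succ_pos i k).ne', mul_one,
    siteWeight]

/-- The reversible weight of a configuration. Configurations on a set `S` of sites are represented
by functions that vanish outside `S`, so that the same product serves for all `S`. -/
noncomputable def weight [Fintype ι] (r : ι → ℕ → ℝ) (x : ι → ℕ) : ℝ :=
  ∏ i, siteWeight r i (x i)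

theorem weight_pos [Fintype ι] (hr : IsRate δ Δ r) (x : ι → ℕ) : 0 < weight r x :=
  prod_pos fun i _ => siteWeight_pos hr i (x i)

variable [DecidableEq ι]

theorem add_single_mem {l : ℕ} {x : ι → ℕ} (hx : x ∈ piAntidiag S l) {i : ι} (hi : i ∈ S) (k : ℕ) :
    x + Pi.single i k ∈ piAntidiag S (l + k) := by
  rw [mem_piAntidiag] at hx ⊢
  refine ⟨?_, fun j hj => ?_⟩
  · simp [sum_add_distrib, hx.1, sum_pi_single', hi]
  · by_cases hji : j = i
    · exact hji ▸ hi
    · exact hx.2 j (by simpa [hji] using hj)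

theorem sub_single_add_single {x : ι → ℕ} {i : ι} (hi : 0 < x i) :
    x - Pi.single i 1 + Pi.single i 1 = x := by
  ext j
  by_cases hji : j = i
  · subst hji; simp; omega
  · simp [hji]

theorem sub_single_mem {l : ℕ} {x : ι → ℕ} (hx : x ∈ piAntidiag S (l + 1)) {i : ι}
    (hi : 0 < x i) : x - Pi.single i 1 ∈ piAntidiag S l := by
  rw [mem_piAntidiag] at hx ⊢
  have hiS : i ∈ S := hx.2 i hi.ne'
  refine ⟨?_, fun j hj => hx.2 j fun h0 => hj (by simp [h0])⟩
  have h1 := hx.1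
  rw [← sub_single_add_single hi] at h1
  simpa [sum_add_distrib, sum_pi_single', hiS] using h1

theorem eq_zero_of_mem_zero {x : ι → ℕ} (hx : x ∈ piAntidiag S 0) : x = 0 := by
  simpa using hx

/-- Splitting configurations according to the number of particles at the site `i`. -/
theorem sum_piAntidiag_eq {i : ι} (hi : i ∈ S) (l : ℕ) (H : (ι → ℕ) → ℝ) :
    ∑ x ∈ piAntidiag S l, H x
      = ∑ k ∈ range (l + 1), ∑ y ∈ piAntidiag (S.erase i) (l - k), H (y + Pi.single i k) := by
  have hS : S = cons i (S.erase i) (notMem_erase i S) := by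
    rw [cons_eq_insert, insert_erase hi]
  conv_lhs => rw [hS]
  rw [piAntidiag_cons, sum_disjiUnion,
    Nat.sum_antidiagonal_eq_sum_range_succ_mk]
  refine sum_congr rfl fun k _ => ?_
  rw [sum_map]
  refine sum_congr rfl fun y _ => ?_
  congr 1
  ext j
  simp [Pi.single_apply]

theorem apply_eq_zero_of_mem_erase {i : ι} {l : ℕ} {y : ι → ℕ}
    (hy : y ∈ piAntidiag (S.erase i) l) : y i = 0 := by
  by_contra h
  exact notMem_erase i S ((mem_piAntidiag.1 hy).2 i h)

/-- Connectivity of the space of configurations. -/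
theorem eq_of_forall_add_single_eq {l : ℕ} {h : (ι → ℕ) → ℝ}
    (hh : ∀ y ∈ piAntidiag S l, ∀ i ∈ S, ∀ k ∈ S, h (y + Pi.single i 1) = h (y + Pi.single k 1))
    {x x' : ι → ℕ} (hx : x ∈ piAntidiag S (l + 1)) (hx' : x' ∈ piAntidiag S (l + 1)) :
    h x = h x' := by
  obtain ⟨a, ha⟩ : S.Nonempty := by
    rw [nonempty_iff_ne_empty]
    rintro rfl
    simp at hx
  have key : ∀ j k, k + j = l + 1 → ∀ z ∈ piAntidiag S j,
      h (z + Pi.single a k) = h (Pi.single a (l + 1)) := by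
    intro j
    induction j with
    | zero =>
      intro k hk z hz
      rw [eq_zero_of_mem_zero hz, zero_add, ← hk, add_zero]
    | succ j ih =>
      intro k hk z hz
      obtain ⟨b, hb⟩ : ∃ b, 0 < z b := by
        by_contra! hcon
        have := (mem_piAntidiag.1 hz).1
        rw [sum_eq_zero fun i _ => Nat.le_zero.1 (hcon i)] at this
        omega
      have hbS := (mem_piAntidiag.1 hz).2 b hb.ne'
      have hy := sub_single_mem hz hb
      have hy' := add_single_mem hy ha k
      have := hh (z - Pi.single b 1 + Pi.single a k) (by convert hy' using 2; omega) b hbS a ha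
      rw [add_right_comm, sub_single_add_single hb, add_assoc, ← Pi.single_add] at this
      rw [this]
      exact ih (k + 1) (by omega) _ hy
  have h1 := key (l + 1) 0 (by omega) x hx
  have h2 := key (l + 1) 0 (by omega) x' hx'
  simp only [Pi.single_zero, add_zero] at h1 h2
  rw [h1, h2]

variable [Fintype ι]

/-- The total weight of the configurations of `l` particles on `S`. -/
noncomputable def partition (r : ι → ℕ → ℝ) (S : Finset ι) (l : ℕ) : ℝ :=
  ∑ x ∈ piAntidiag S l, weight r x

/-- The generator of the zero-range process on `S`, multiplied by the number of sites. -/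
noncomputable def gen (r : ι → ℕ → ℝ) (S : Finset ι) (h : (ι → ℕ) → ℝ) (x : ι → ℕ) : ℝ :=
  ∑ i ∈ S, ∑ k ∈ S, r i (x i) * (h (x - Pi.single i 1 + Pi.single k 1) - h x)

theorem weight_add_single_mul (hr : IsRate δ Δ r) (x : ι → ℕ) (i : ι) :
    weight r (x + Pi.single i 1) * r i (x i + 1) = weight r x := by
  unfold weight
  rw [← mul_prod_erase univ _ (mem_univ i), ← mul_prod_erase univ _ (mem_univ i)]
  have e : ∏ j ∈ univ.erase i, siteWeight r j ((x + Pi.single i 1 : ι → ℕ) j)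
      = ∏ j ∈ univ.erase i, siteWeight r j (x j) :=
    prod_congr rfl fun j hj => by simp [ne_of_mem_erase hj]
  rw [e]
  have := siteWeight_succ_mul hr i (x i)
  simp only [Pi.add_apply, Pi.single_eq_same]
  linear_combination (∏ j ∈ univ.erase i, siteWeight r j (x j)) * this

theorem weight_add_single (r : ι → ℕ → ℝ) {x : ι → ℕ} {i : ι} (hx : x i = 0) (k : ℕ) :
    weight r (x + Pi.single i k) = siteWeight r i k * weight r x := by
  unfold weight
  rw [← mul_prod_erase univ _ (mem_univ i), ← mul_prod_erase univ _ (mem_univ i)]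
  have e : ∏ j ∈ univ.erase i, siteWeight r j ((x + Pi.single i k : ι → ℕ) j)
      = ∏ j ∈ univ.erase i, siteWeight r j (x j) :=
    prod_congr rfl fun j hj => by simp [ne_of_mem_erase hj]
  rw [e]
  simp [hx, siteWeight]

/-- A configuration of `l + 1` particles with one marked particle at `i` is a configuration of `l`
particles. -/
theorem sum_weight_mul_rate (hr : IsRate δ Δ r) {i : ι} (hi : i ∈ S) (l : ℕ) (G : (ι → ℕ) → ℝ) :
    ∑ x ∈ piAntidiag S (l + 1), weight r x * (r i (x i) * G x)
      = ∑ y ∈ piAntidiag S l, weight r y * G (y + Pi.single i 1) := by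
  symm
  refine sum_of_injOn (fun y => y + Pi.single i 1) (add_left_injective _).injOn
    (fun y hy => add_single_mem hy hi 1) (fun x hx hx' => ?_) (fun y _ => ?_)
  · rcases Nat.eq_zero_or_pos (x i) with h0 | h0
    · rw [h0, hr.zero, zero_mul, mul_zero]
    · exact absurd ⟨_, sub_single_mem hx h0, sub_single_add_single h0⟩ hx'
  · rw [← mul_assoc]
    simp only [Pi.add_apply, Pi.single_eq_same]
    rw [weight_add_single_mul hr]

theorem sum_weight_mul_gen (hr : IsRate δ Δ r) (l : ℕ) (g h : (ι → ℕ) → ℝ) :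
    ∑ x ∈ piAntidiag S (l + 1), weight r x * (g x * gen r S h x)
      = ∑ y ∈ piAntidiag S l, weight r y * ∑ i ∈ S, ∑ k ∈ S,
        g (y + Pi.single i 1) * (h (y + Pi.single k 1) - h (y + Pi.single i 1)) := by
  have e1 : ∀ x, weight r x * (g x * gen r S h x) = ∑ i ∈ S, ∑ k ∈ S, weight r x *
      (r i (x i) * (g x * (h (x - Pi.single i 1 + Pi.single k 1) - h x))) := by
    intro x
    unfold gen
    simp only [mul_sum]
    exact sum_congr rfl fun i _ => sum_congr rfl fun k _ => by ring
  simp only [e1, mul_sum]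
  rw [sum_comm, sum_comm (s := piAntidiag S l)]
  refine sum_congr rfl fun i hi => ?_
  rw [sum_comm, sum_comm (s := piAntidiag S l)]
  refine sum_congr rfl fun k _ => ?_
  rw [sum_weight_mul_rate hr hi]
  simp only [add_tsub_cancel_right]

/-- Reversibility. -/
theorem sum_weight_mul_gen_comm (hr : IsRate δ Δ r) (l : ℕ) (g h : (ι → ℕ) → ℝ) :
    ∑ x ∈ piAntidiag S l, weight r x * (g x * gen r S h x)
      = ∑ x ∈ piAntidiag S l, weight r x * (h x * gen r S g x) := by
  cases l with
  | zero =>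
    refine sum_congr rfl fun x hx => ?_
    rw [eq_zero_of_mem_zero hx]
    simp [gen, hr.zero]
  | succ l =>
    rw [sum_weight_mul_gen hr, sum_weight_mul_gen hr]
    refine sum_congr rfl fun y _ => ?_
    congr 1
    simp only [mul_sub, sum_sub_distrib]
    congr 1
    · rw [sum_comm]
      exact sum_congr rfl fun i _ => sum_congr rfl fun k _ => mul_comm _ _
    · exact sum_congr rfl fun i _ => sum_congr rfl fun k _ => mul_comm _ _

/-- A function with vanishing Dirichlet form, in particular a harmonic one, is constant. -/
theorem eq_of_gen_eq_zero (hr : IsRate δ Δ r) {l : ℕ} {h : (ι → ℕ) → ℝ}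
    (hh : ∑ x ∈ piAntidiag S l, weight r x * (h x * gen r S h x) = 0)
    {x x' : ι → ℕ} (hx : x ∈ piAntidiag S l) (hx' : x' ∈ piAntidiag S l) :
    h x = h x' := by
  cases l with
  | zero => rw [eq_zero_of_mem_zero hx, eq_zero_of_mem_zero hx']
  | succ l =>
    rw [sum_weight_mul_gen hr] at hh
    have e : ∀ y : ι → ℕ, ∑ i ∈ S, ∑ k ∈ S,
        h (y + Pi.single i 1) * (h (y + Pi.single k 1) - h (y + Pi.single i 1))
        = -(1 / 2) * ∑ i ∈ S, ∑ k ∈ S, (h (y + Pi.single k 1) - h (y + Pi.single i 1)) ^ 2 := by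
      intro y
      have e1 : ∑ i ∈ S, ∑ k ∈ S, h (y + Pi.single i 1) ^ 2
          = ∑ i ∈ S, ∑ k ∈ S, h (y + Pi.single k 1) ^ 2 := sum_comm
      have e2 : ∑ i ∈ S, ∑ k ∈ S, (h (y + Pi.single k 1) - h (y + Pi.single i 1)) ^ 2
          = ∑ i ∈ S, ∑ k ∈ S, h (y + Pi.single k 1) ^ 2
            - ∑ i ∈ S, ∑ k ∈ S, h (y + Pi.single i 1) ^ 2
            - 2 * ∑ i ∈ S, ∑ k ∈ S,
              h (y + Pi.single i 1) * (h (y + Pi.single k 1) - h (y + Pi.single i 1)) := by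
        simp only [mul_sum, ← sum_sub_distrib]
        exact sum_congr rfl fun i _ => sum_congr rfl fun k _ => by ring
      rw [e2, e1]
      ring
    simp only [e] at hh
    have hnn : ∀ y ∈ piAntidiag S l, 0 ≤ weight r y * ∑ i ∈ S, ∑ k ∈ S,
        (h (y + Pi.single k 1) - h (y + Pi.single i 1)) ^ 2 := fun y _ =>
      mul_nonneg (weight_pos hr y).le (sum_nonneg fun i _ => sum_nonneg fun k _ => sq_nonneg _)
    have hs : ∑ y ∈ piAntidiag S l, weight r y * ∑ i ∈ S, ∑ k ∈ S,
        (h (y + Pi.single k 1) - h (y + Pi.single i 1)) ^ 2 = 0 := by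
      simp only [mul_left_comm _ (-(1 / 2) : ℝ), ← mul_sum] at hh
      linarith
    refine eq_of_forall_add_single_eq (fun y hy i hi k hk => ?_) hx hx'
    have h1 := (sum_eq_zero_iff_of_nonneg hnn).1 hs y hy
    have h2 := (mul_eq_zero.1 h1).resolve_left (weight_pos hr y).ne'
    have h3 := (sum_eq_zero_iff_of_nonneg fun i _ => sum_nonneg fun k _ => sq_nonneg _).1 h2 i hi
    have h4 := (sum_eq_zero_iff_of_nonneg fun k _ => sq_nonneg _).1 h3 k hk
    linarith [pow_eq_zero_iff two_ne_zero |>.1 h4]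

theorem partition_pos (hr : IsRate δ Δ r) (hS : S.Nonempty) (l : ℕ) : 0 < partition r S l := by
  obtain ⟨a, ha⟩ := hS
  refine sum_pos (fun x _ => weight_pos hr x) ⟨Pi.single a l, ?_⟩
  have := add_single_mem (S := S) (l := 0) (x := 0) (by simp) ha l
  simpa using this

end ZeroRange

/-! ### Coupling the equilibria with `l` and `l + 1` particles -/

namespace ZeroRange

open Finset

variable {ι : Type*} {δ Δ : ℝ} {r : ι → ℕ → ℝ} {S : Finset ι}

/-- The increment of the rate at the site `j` when a particle is added there. -/
def rateGap (r : ι → ℕ → ℝ) (j : ι) (x : ι → ℕ) : ℝ := r j (x j + 1) - r j (x j)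

theorem rateGap_pos (hr : IsRate δ Δ r) (j : ι) (x : ι → ℕ) : 0 < rateGap r j x :=
  hr.pos.trans_le (hr.gap j (x j))

variable [DecidableEq ι]

/-- Zero-range processes with `l` and `l + 1` particles can be run together so that they differ by
one extra particle, at a site `j` that jumps to a uniform site at rate `rateGap r j x`. This is the
forward operator of the resulting chain of pairs `(x, j)`, multiplied by the number of sites and
acting on densities with respect to the reversible weight of `x`. -/
noncomputable def markGen (r : ι → ℕ → ℝ) (S : Finset ι) (h : (ι → ℕ) → ι → ℝ) (x : ι → ℕ)
    (j : ι) : ℝ :=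
  gen r S (fun x => h x j) x + ∑ k ∈ S, rateGap r k x * h x k - #S * (rateGap r j x * h x j)

/-- The backward operator of the chain of pairs `(x, j)`, applied to a function of `x + δ_j`, is the
generator with one more particle. -/
theorem gen_add_single (hr : IsRate δ Δ r) (G : (ι → ℕ) → ℝ) (x : ι → ℕ) {j : ι} (hj : j ∈ S) :
    gen r S (fun x => G (x + Pi.single j 1)) x
        + rateGap r j x * ∑ k ∈ S, (G (x + Pi.single k 1) - G (x + Pi.single j 1))
      = gen r S G (x + Pi.single j 1) := by
  have key : ∀ i ∈ S, ∑ k ∈ S, r i ((x + Pi.single j 1 : ι → ℕ) i)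
        * (G (x + Pi.single j 1 - Pi.single i 1 + Pi.single k 1) - G (x + Pi.single j 1))
      = ∑ k ∈ S, r i (x i)
          * (G (x - Pi.single i 1 + Pi.single k 1 + Pi.single j 1) - G (x + Pi.single j 1))
        + if j = i then
            rateGap r j x * ∑ k ∈ S, (G (x + Pi.single k 1) - G (x + Pi.single j 1)) else 0 := by
    intro i _
    have hcomm : r i (x i) ≠ 0 → ∀ k, x - Pi.single i 1 + Pi.single k 1 + Pi.single j 1
        = x + Pi.single j 1 - Pi.single i 1 + Pi.single k 1 := by
      intro h0 k
      have hx : 0 < x i := Nat.pos_of_ne_zero fun h => h0 (by rw [h, hr.zero])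
      have h1 := sub_single_add_single hx
      conv_rhs => rw [← h1, add_right_comm, add_tsub_cancel_right]
      exact add_right_comm _ _ _
    have e1 : ∑ k ∈ S, r i (x i)
          * (G (x - Pi.single i 1 + Pi.single k 1 + Pi.single j 1) - G (x + Pi.single j 1))
        = ∑ k ∈ S, r i (x i)
          * (G (x + Pi.single j 1 - Pi.single i 1 + Pi.single k 1) - G (x + Pi.single j 1)) := by
      refine sum_congr rfl fun k _ => ?_
      by_cases h0 : r i (x i) = 0
      · rw [h0, zero_mul, zero_mul]
      · rw [hcomm h0]
    rw [e1]
    split_ifs with hji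
    · subst hji
      simp only [Pi.add_apply, Pi.single_eq_same, add_tsub_cancel_right, ← mul_sum, rateGap]
      ring
    · simp [Ne.symm hji]
  unfold gen
  rw [sum_congr rfl key, sum_add_distrib, sum_ite_eq, if_pos hj]

variable [Fintype ι]

/-- Duality between the forward and the backward operator. -/
theorem sum_weight_mul_markGen (hr : IsRate δ Δ r) (l : ℕ) (g h : (ι → ℕ) → ι → ℝ) :
    ∑ x ∈ piAntidiag S l, ∑ j ∈ S, weight r x * (g x j * markGen r S h x j)
      = ∑ x ∈ piAntidiag S l, ∑ j ∈ S, weight r x * (h x j *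
          (gen r S (fun x => g x j) x + rateGap r j x * ∑ k ∈ S, (g x k - g x j))) := by
  have e1 : ∑ x ∈ piAntidiag S l, ∑ j ∈ S, weight r x * (g x j * gen r S (fun x => h x j) x)
      = ∑ x ∈ piAntidiag S l, ∑ j ∈ S, weight r x * (h x j * gen r S (fun x => g x j) x) := by
    rw [sum_comm, sum_comm (s := piAntidiag S l)]
    exact sum_congr rfl fun j _ =>
      sum_weight_mul_gen_comm hr l (fun x => g x j) (fun x => h x j)
  have e2 : ∀ x, ∑ j ∈ S, weight r x * (g x j *
        (∑ k ∈ S, rateGap r k x * h x k - #S * (rateGap r j x * h x j)))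
      = ∑ j ∈ S, weight r x * (h x j * (rateGap r j x * ∑ k ∈ S, (g x k - g x j))) := by
    intro x
    simp only [sum_sub_distrib, sum_const, nsmul_eq_mul, mul_sub, ← mul_sum, ← sum_mul]
    congr 1
    · congr 1
      rw [mul_comm, sum_mul]
      exact sum_congr rfl fun j _ => by ring
    · congr 1
      exact sum_congr rfl fun j _ => by ring
  have e3 : ∀ (x : ι → ℕ) (j : ι), weight r x * (g x j * markGen r S h x j)
      = weight r x * (g x j * gen r S (fun x => h x j) x) + weight r x * (g x j *
        (∑ k ∈ S, rateGap r k x * h x k - #S * (rateGap r j x * h x j))) := by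
    intro x j; unfold markGen; ring
  simp only [e3, sum_add_distrib, e1, e2, mul_add]

theorem sum_weight_mul_markGen_eq_zero (hr : IsRate δ Δ r) (l : ℕ) (h : (ι → ℕ) → ι → ℝ) :
    ∑ x ∈ piAntidiag S l, ∑ j ∈ S, weight r x * markGen r S h x j = 0 := by
  have := sum_weight_mul_markGen (S := S) hr l (fun _ _ => 1) h
  simpa [gen] using this

/-- The chain of pairs has an invariant signed measure: its forward operator takes values of total
mass zero, so it is not surjective, hence not injective. -/
theorem exists_markGen_eq_zero (hr : IsRate δ Δ r) (hS : S.Nonempty) (l : ℕ) :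
    ∃ h : (ι → ℕ) → ι → ℝ, (∃ x ∈ piAntidiag S l, ∃ j ∈ S, h x j ≠ 0) ∧
      ∀ x ∈ piAntidiag S l, ∀ j ∈ S, markGen r S h x j = 0 := by
  let X := {q : (ι → ℕ) × ι // q ∈ piAntidiag S l ×ˢ S}
  let e : (X → ℝ) → (ι → ℕ) → ι → ℝ := fun v x j =>
    if hq : (x, j) ∈ piAntidiag S l ×ˢ S then v ⟨(x, j), hq⟩ else 0
  have e_add : ∀ u v x j, e (u + v) x j = e u x j + e v x j := by
    intro u v x j; simp only [e]; split_ifs <;> simp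
  have e_smul : ∀ (a : ℝ) v x j, e (a • v) x j = a * e v x j := by
    intro u v x j; simp only [e]; split_ifs <;> simp
  let A : (X → ℝ) →ₗ[ℝ] (X → ℝ) :=
    { toFun := fun v q => markGen r S (e v) q.1.1 q.1.2
      map_add' := fun u v => by
        ext q
        simp only [markGen, gen, e_add, Pi.add_apply, mul_add, sum_add_distrib, mul_sub,
          sum_sub_distrib]
        ring
      map_smul' := fun a v => by
        ext q
        simp only [markGen, gen, e_smul, Pi.smul_apply, smul_eq_mul, RingHom.id_apply, mul_sub,
          mul_add, mul_sum, sum_sub_distrib, mul_left_comm _ a] }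
  have hnotsurj : ¬ Function.Surjective A := by
    intro hsurj
    obtain ⟨v, hv⟩ := hsurj fun _ => 1
    have hv' : ∀ x ∈ piAntidiag S l, ∀ j ∈ S, markGen r S (e v) x j = 1 := fun x hx j hj =>
      congrFun hv ⟨(x, j), mem_product.2 ⟨hx, hj⟩⟩
    have h0 := sum_weight_mul_markGen_eq_zero (S := S) hr l (e v)
    rw [sum_congr rfl fun x hx => sum_congr rfl fun j hj => by rw [hv' x hx j hj, mul_one]] at h0
    simp only [sum_const, nsmul_eq_mul, ← mul_sum] at h0
    have h1 := partition_pos hr hS l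
    have h2 : (0 : ℝ) < #S := by exact_mod_cast hS.card_pos
    exact (mul_pos h2 h1).ne' h0
  have hnotinj : ¬ Function.Injective A := fun h =>
    hnotsurj (LinearMap.injective_iff_surjective.1 h)
  rw [injective_iff_map_eq_zero] at hnotinj
  push Not at hnotinj
  obtain ⟨v, hv, hv0⟩ := hnotinj
  obtain ⟨⟨⟨x, j⟩, hq⟩, hne⟩ := Function.ne_iff.1 hv0
  refine ⟨e v, ⟨x, (mem_product.1 hq).1, j, (mem_product.1 hq).2, ?_⟩, fun x hx j hj =>
    congrFun hv ⟨(x, j), mem_product.2 ⟨hx, hj⟩⟩⟩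
  simp only [e, dif_pos hq]
  exact hne

/-- The absolute value of an invariant signed measure is invariant. -/
theorem exists_nonneg_markGen_eq_zero (hr : IsRate δ Δ r) (hS : S.Nonempty) (l : ℕ) :
    ∃ h : (ι → ℕ) → ι → ℝ, (∀ x j, 0 ≤ h x j) ∧ (∃ x ∈ piAntidiag S l, ∃ j ∈ S, h x j ≠ 0) ∧
      ∀ x ∈ piAntidiag S l, ∀ j ∈ S, markGen r S h x j = 0 := by
  obtain ⟨h, ⟨x₀, hx₀, j₀, hj₀, hne⟩, hh⟩ := exists_markGen_eq_zero hr hS l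
  refine ⟨fun x j => |h x j|, fun x j => abs_nonneg _,
    ⟨x₀, hx₀, j₀, hj₀, abs_ne_zero.2 hne⟩, ?_⟩
  have hsplit : ∀ (f : (ι → ℕ) → ι → ℝ) (x : ι → ℕ) (j : ι), markGen r S f x j
      = ∑ i ∈ S, ∑ k ∈ S, r i (x i) * f (x - Pi.single i 1 + Pi.single k 1) j
        + ∑ k ∈ S, rateGap r k x * f x k
        - (∑ i ∈ S, ∑ _k ∈ S, r i (x i) + #S * rateGap r j x) * f x j := by
    intro f x j
    simp only [markGen, gen, mul_sub, sum_sub_distrib, add_mul, sum_mul]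
    ring
  have hnn : ∀ x ∈ piAntidiag S l, ∀ j ∈ S,
      0 ≤ weight r x * markGen r S (fun x j => |h x j|) x j := by
    intro x hx j hj
    refine mul_nonneg (weight_pos hr x).le ?_
    have h1 := hh x hx j hj
    rw [hsplit, sub_eq_zero] at h1
    rw [hsplit, sub_nonneg]
    have hc : 0 ≤ ∑ i ∈ S, ∑ _k ∈ S, r i (x i) + #S * rateGap r j x :=
      add_nonneg (sum_nonneg fun i _ => sum_nonneg fun k _ => hr.nonneg i _)
        (mul_nonneg (Nat.cast_nonneg _) (rateGap_pos hr j x).le)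
    nth_rewrite 1 [← abs_of_nonneg hc]
    rw [← abs_mul, ← h1]
    refine (abs_add_le _ _).trans (add_le_add ?_ ?_)
    · refine (abs_sum_le_sum_abs _ _).trans (sum_le_sum fun i _ => ?_)
      refine (abs_sum_le_sum_abs _ _).trans (sum_le_sum fun k _ => ?_)
      rw [abs_mul, abs_of_nonneg (hr.nonneg i _)]
    · refine (abs_sum_le_sum_abs _ _).trans (sum_le_sum fun k _ => ?_)
      rw [abs_mul, abs_of_nonneg (rateGap_pos hr k x).le]
  have hsum := sum_weight_mul_markGen_eq_zero (S := S) hr l (fun x j => |h x j|)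
  intro x hx j hj
  have h1 := (sum_eq_zero_iff_of_nonneg fun x hx => sum_nonneg (hnn x hx)).1 hsum x hx
  have h2 := (sum_eq_zero_iff_of_nonneg (hnn x hx)).1 h1 j hj
  exact (mul_eq_zero.1 h2).resolve_left (weight_pos hr x).ne'

/-- The equilibrium with `l + 1` particles is obtained from the equilibrium with `l` particles by
adding a particle at a random site, whose conditional law given the configuration is dominated by
`Δ / δ` times the uniform law. -/
theorem exists_coupling (hr : IsRate δ Δ r) (hS : S.Nonempty) (l : ℕ) :
    ∃ K : (ι → ℕ) → ι → ℝ, (∀ x j, 0 ≤ K x j) ∧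
      (∀ x ∈ piAntidiag S l, ∑ j ∈ S, K x j = 1) ∧
      (∀ x ∈ piAntidiag S l, ∀ j ∈ S, K x j ≤ Δ / δ / #S) ∧
      ∀ G : (ι → ℕ) → ℝ, partition r S (l + 1) *
          ∑ x ∈ piAntidiag S l, weight r x * ∑ j ∈ S, K x j * G (x + Pi.single j 1)
        = partition r S l * ∑ y ∈ piAntidiag S (l + 1), weight r y * G y := by
  obtain ⟨h, hnn, ⟨x₀, hx₀, j₀, hj₀, hne⟩, hh⟩ := exists_nonneg_markGen_eq_zero hr hS l
  have hδ := hr.pos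
  have hcard : (0 : ℝ) < #S := by exact_mod_cast hS.card_pos
  -- The first marginal is invariant for the zero-range process, so it is the equilibrium.
  have hgen : ∀ x ∈ piAntidiag S l, gen r S (fun x => ∑ j ∈ S, h x j) x = 0 := by
    intro x hx
    have h1 : ∑ j ∈ S, markGen r S h x j = 0 := sum_eq_zero fun j hj => hh x hx j hj
    have h2 : gen r S (fun x => ∑ j ∈ S, h x j) x = ∑ j ∈ S, gen r S (fun x => h x j) x := by
      unfold gen
      rw [eq_comm, sum_comm]
      refine sum_congr rfl fun i _ => ?_
      rw [sum_comm]
      refine sum_congr rfl fun k _ => ?_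
      rw [← sum_sub_distrib, mul_sum]
    have h3 : ∑ j ∈ S, markGen r S h x j = ∑ j ∈ S, gen r S (fun x => h x j) x := by
      simp only [markGen, sum_sub_distrib, sum_add_distrib, sum_const, nsmul_eq_mul, ← mul_sum]
      ring
    rw [h2, ← h3, h1]
  set H := ∑ j ∈ S, h x₀ j with hH
  have hHx : ∀ x ∈ piAntidiag S l, ∑ j ∈ S, h x j = H := fun x hx =>
    eq_of_gen_eq_zero hr (h := fun x => ∑ j ∈ S, h x j)
      (sum_eq_zero fun x hx => by rw [hgen x hx, mul_zero, mul_zero]) hx hx₀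
  have hHpos : 0 < H := sum_pos' (fun j _ => hnn x₀ j) ⟨j₀, hj₀, (hnn x₀ j₀).lt_of_ne' hne⟩
  -- The maximum principle bounds the density.
  have hbound : ∀ x ∈ piAntidiag S l, ∀ j ∈ S, h x j ≤ Δ / δ / #S * H := by
    obtain ⟨q, hq, hmax⟩ := exists_max_image (piAntidiag S l ×ˢ S) (fun q => h q.1 q.2)
      ⟨(x₀, j₀), mem_product.2 ⟨hx₀, hj₀⟩⟩
    obtain ⟨a, c⟩ := q
    obtain ⟨ha, hc⟩ : a ∈ piAntidiag S l ∧ c ∈ S := mem_product.1 hq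
    have h1 := hh a ha c hc
    have h2 : gen r S (fun x => h x c) a ≤ 0 := by
      refine sum_nonpos fun i hi => sum_nonpos fun k hk => ?_
      rcases Nat.eq_zero_or_pos (a i) with h0 | h0
      · rw [h0, hr.zero, zero_mul]
      · refine mul_nonpos_of_nonneg_of_nonpos (hr.nonneg i _) (sub_nonpos.2 ?_)
        have hl : l ≠ 0 := by
          rintro rfl
          rw [eq_zero_of_mem_zero ha] at h0
          simp at h0
        obtain ⟨l', rfl⟩ := Nat.exists_eq_succ_of_ne_zero hl
        exact hmax (_, c) (mem_product.2 ⟨add_single_mem (sub_single_mem ha h0) hk 1, hc⟩)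
    have h3 : ∑ k ∈ S, rateGap r k a * h a k ≤ Δ * H := by
      rw [← hHx a ha, mul_sum]
      exact sum_le_sum fun k _ => mul_le_mul_of_nonneg_right (hr.gap_le k _) (hnn a k)
    have h4 : δ * h a c ≤ rateGap r c a * h a c :=
      mul_le_mul_of_nonneg_right (hr.gap c _) (hnn a c)
    have h5 : #S * (δ * h a c) ≤ Δ * H := by
      have := mul_le_mul_of_nonneg_left h4 hcard.le
      unfold markGen at h1
      linarith
    intro x hx j hj
    refine (hmax (x, j) (mem_product.2 ⟨hx, hj⟩)).trans ?_
    rw [div_div, div_mul_eq_mul_div, le_div_iff₀ (by positivity)]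
    linarith
  -- The law of `x + δ_j` is invariant for the zero-range process with `l + 1` particles, so it is
  -- the equilibrium.
  have hΛ : ∀ G : (ι → ℕ) → ℝ,
      ∑ x ∈ piAntidiag S l, weight r x * ∑ j ∈ S, h x j * G (x + Pi.single j 1)
        = ∑ y ∈ piAntidiag S (l + 1),
          weight r y * (G y * ∑ j ∈ S, r j (y j) * h (y - Pi.single j 1) j) := by
    intro G
    simp only [mul_sum]
    rw [sum_comm, sum_comm (s := piAntidiag S (l + 1))]
    refine sum_congr rfl fun j hj => ?_
    have := sum_weight_mul_rate hr hj l fun y => G y * h (y - Pi.single j 1) j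
    simp only [add_tsub_cancel_right] at this
    rw [sum_congr rfl fun x _ => by rw [mul_comm (h x j)], ← this]
    exact sum_congr rfl fun y _ => by ring
  set ρ : (ι → ℕ) → ℝ := fun y => ∑ j ∈ S, r j (y j) * h (y - Pi.single j 1) j with hρ
  have hinv : ∑ y ∈ piAntidiag S (l + 1), weight r y * (ρ y * gen r S ρ y) = 0 := by
    have h1 := hΛ (gen r S ρ)
    have h2 := sum_weight_mul_markGen (S := S) hr l (fun x j => ρ (x + Pi.single j 1)) h
    rw [sum_eq_zero fun x hx => sum_eq_zero fun j hj => by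
      rw [hh x hx j hj, mul_zero, mul_zero]] at h2
    rw [sum_congr rfl fun x _ => sum_congr rfl fun j hj => by
      rw [gen_add_single hr ρ x hj]] at h2
    simp only [← mul_sum] at h2
    rw [← h2] at h1
    rw [h1]
    exact sum_congr rfl fun y _ => by ring
  have hy₀ := add_single_mem hx₀ hj₀ 1
  set c := ρ (x₀ + Pi.single j₀ 1) with hc
  have hρc : ∀ y ∈ piAntidiag S (l + 1), ρ y = c := fun y hy => eq_of_gen_eq_zero hr hinv hy hy₀
  have hΛ' : ∀ G : (ι → ℕ) → ℝ,
      ∑ x ∈ piAntidiag S l, weight r x * ∑ j ∈ S, h x j * G (x + Pi.single j 1)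
        = c * ∑ y ∈ piAntidiag S (l + 1), weight r y * G y := by
    intro G
    rw [hΛ, mul_sum]
    refine sum_congr rfl fun y hy => ?_
    have : ∑ j ∈ S, r j (y j) * h (y - Pi.single j 1) j = c := hρc y hy
    rw [this]
    ring
  have hmass : H * partition r S l = c * partition r S (l + 1) := by
    have := hΛ' fun _ => 1
    simp only [mul_one] at this
    rw [partition, partition, ← this, mul_sum]
    exact sum_congr rfl fun x hx => by rw [hHx x hx, mul_comm]
  refine ⟨fun x j => h x j / H, fun x j => div_nonneg (hnn x j) hHpos.le, fun x hx => ?_,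
    fun x hx j hj => ?_, fun G => ?_⟩
  · rw [← sum_div, hHx x hx, div_self hHpos.ne']
  · rw [div_le_iff₀ hHpos]
    exact hbound x hx j hj
  · have e : ∑ x ∈ piAntidiag S l, weight r x * ∑ j ∈ S, h x j / H * G (x + Pi.single j 1)
        = (c * ∑ y ∈ piAntidiag S (l + 1), weight r y * G y) / H := by
      rw [← hΛ', sum_div]
      refine sum_congr rfl fun x _ => ?_
      rw [mul_div_assoc, sum_div]
      congr 1
      exact sum_congr rfl fun j _ => by ring
    rw [e, ← mul_div_assoc, div_eq_iff hHpos.ne']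
    linear_combination -(∑ y ∈ piAntidiag S (l + 1), weight r y * G y) * hmass

end ZeroRange

/-! ### The number of particles at one site -/

namespace ZeroRange

open Finset

variable {ι : Type*} [DecidableEq ι] [Fintype ι] {δ Δ : ℝ} {r : ι → ℕ → ℝ} {S : Finset ι}

theorem sum_weight_mul_rate_apply (hr : IsRate δ Δ r) {i : ι} (hi : i ∈ S) (l : ℕ) :
    ∑ x ∈ piAntidiag S (l + 1), weight r x * r i (x i) = partition r S l := by
  simpa [partition] using sum_weight_mul_rate hr hi l fun _ => 1

theorem sum_weight_mul_sum_rate (hr : IsRate δ Δ r) (l : ℕ) :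
    ∑ x ∈ piAntidiag S (l + 1), weight r x * ∑ i ∈ S, r i (x i) = #S * partition r S l := by
  simp only [mul_sum]
  rw [sum_comm, sum_congr rfl fun i hi => sum_weight_mul_rate_apply hr hi l, sum_const,
    nsmul_eq_mul]

theorem cast_sum_eq {ι : Type*} [DecidableEq ι] {S : Finset ι} {l : ℕ} {x : ι → ℕ}
    (hx : x ∈ piAntidiag S l) : ∑ i ∈ S, (x i : ℝ) = l := by
  rw [← Nat.cast_sum, (mem_piAntidiag.1 hx).1]

theorem mul_partition_succ_le (hr : IsRate δ Δ r) (l : ℕ) :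
    δ * (l + 1) * partition r S (l + 1) ≤ #S * partition r S l := by
  rw [← sum_weight_mul_sum_rate hr, partition, mul_sum]
  refine sum_le_sum fun x hx => ?_
  rw [mul_comm]
  refine mul_le_mul_of_nonneg_left ?_ (weight_pos hr x).le
  have := cast_sum_eq hx
  push_cast at this
  rw [← this, mul_sum]
  exact sum_le_sum fun i _ => hr.mul_le i _

theorem le_mul_partition_succ (hr : IsRate δ Δ r) (l : ℕ) :
    #S * partition r S l ≤ Δ * (l + 1) * partition r S (l + 1) := by
  rw [← sum_weight_mul_sum_rate hr, partition, mul_sum]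
  refine sum_le_sum fun x hx => ?_
  rw [mul_comm _ (weight r x)]
  refine mul_le_mul_of_nonneg_left ?_ (weight_pos hr x).le
  have := cast_sum_eq hx
  push_cast at this
  rw [← this, mul_sum]
  exact sum_le_sum fun i _ => hr.le_mul i _

/-- Log-concavity of the partition function: adding a particle increases the mean rate. -/
theorem partition_mul_partition_le (hr : IsRate δ Δ r) (hS : S.Nonempty) (l : ℕ) :
    partition r S l * partition r S (l + 2) ≤ partition r S (l + 1) * partition r S (l + 1) := by
  obtain ⟨K, hK0, hK1, -, hK⟩ := exists_coupling hr hS (l + 1)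
  obtain ⟨i, hi⟩ := hS
  have h1 := hK fun y => r i (y i)
  rw [sum_weight_mul_rate_apply hr hi (l + 1)] at h1
  rw [← h1, mul_comm]
  refine mul_le_mul_of_nonneg_left ?_ (partition_pos hr ⟨i, hi⟩ _).le
  rw [← sum_weight_mul_rate_apply hr hi l]
  refine sum_le_sum fun x hx => mul_le_mul_of_nonneg_left ?_ (weight_pos hr x).le
  rw [← one_mul (r i (x i)), ← hK1 x hx, sum_mul]
  exact sum_le_sum fun j _ => mul_le_mul_of_nonneg_left (hr.monotone i (by simp)) (hK0 x j)

/-- The weight of the configurations of `m` particles on `S` with `k` particles at the site `i`. -/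
noncomputable def siteLaw (r : ι → ℕ → ℝ) (S : Finset ι) (i : ι) (m k : ℕ) : ℝ :=
  siteWeight r i k * partition r (S.erase i) (m - k)

/-- The birth rate for which `siteLaw` is reversible when the death rate is `r i`. It is the mean
rate at equilibrium of a site of `S.erase i`, on which there are `m - k` particles. -/
noncomputable def siteBirth (r : ι → ℕ → ℝ) (S : Finset ι) (i : ι) (m k : ℕ) : ℝ :=
  if k < m then partition r (S.erase i) (m - 1 - k) / partition r (S.erase i) (m - k) else 0

theorem siteLaw_mul_siteBirth (hr : IsRate δ Δ r) {i : ι} (hT : (S.erase i).Nonempty) {m k : ℕ}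
    (hk : k < m) : siteLaw r S i m k * siteBirth r S i m k
      = siteWeight r i k * partition r (S.erase i) (m - 1 - k) := by
  rw [siteLaw, siteBirth, if_pos hk, mul_assoc, mul_div_cancel₀ _ (partition_pos hr hT _).ne']

theorem isMonotoneBirthDeath (hr : IsRate δ Δ r) {i : ι} (hT : (S.erase i).Nonempty) (m : ℕ) :
    IsMonotoneBirthDeath m δ (siteLaw r S i m) (siteBirth r S i m) (r i) where
  gap_pos := hr.pos
  weight_pos k _ := mul_pos (siteWeight_pos hr i k) (partition_pos hr hT _)
  birth_pos k hk := by
    rw [siteBirth, if_pos hk]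
    exact div_pos (partition_pos hr hT _) (partition_pos hr hT _)
  birth_last := if_neg (lt_irrefl m)
  birth_anti k hk := by
    rw [siteBirth, siteBirth, if_pos hk]
    split_ifs with hk'
    · obtain ⟨l, rfl⟩ : ∃ l, m = l + 2 + k := ⟨m - 2 - k, by omega⟩
      have e1 : l + 2 + k - 1 - (k + 1) = l := by omega
      have e2 : l + 2 + k - (k + 1) = l + 1 := by omega
      have e3 : l + 2 + k - 1 - k = l + 1 := by omega
      have e4 : l + 2 + k - k = l + 2 := by omega
      rw [e1, e2, e3, e4, div_le_div_iff₀ (partition_pos hr hT _) (partition_pos hr hT _)]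
      exact partition_mul_partition_le hr hT l
    · exact div_nonneg (partition_pos hr hT _).le (partition_pos hr hT _).le
  death_zero := hr.zero i
  death_gap k _ := hr.gap i k
  balance k hk := by
    rw [siteLaw_mul_siteBirth hr hT hk, siteLaw, ← siteWeight_succ_mul hr,
      show m - (k + 1) = m - 1 - k by omega]
    ring

theorem siteBirth_le (hr : IsRate δ Δ r) {i : ι} (hT : (S.erase i).Nonempty) {m k : ℕ}
    (hk : k ≤ m) : siteBirth r S i m k ≤ Δ * (m - k) := by
  rcases hk.lt_or_eq with hk | rfl
  · obtain ⟨l, rfl⟩ : ∃ l, m = l + 1 + k := ⟨m - 1 - k, by omega⟩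
    have e1 : l + 1 + k - 1 - k = l := by omega
    have e2 : l + 1 + k - k = l + 1 := by omega
    rw [siteBirth, if_pos hk, e1, e2, div_le_iff₀ (partition_pos hr hT _)]
    have h1 := le_mul_partition_succ (S := S.erase i) hr l
    have h2 : (1 : ℝ) ≤ #(S.erase i) := by exact_mod_cast hT.card_pos
    have h3 := mul_le_mul_of_nonneg_right h2 (partition_pos hr hT l).le
    push_cast
    rw [add_sub_cancel_right]
    linarith
  · simp [siteBirth]

theorem le_mul_siteBirth (hr : IsRate δ Δ r) {i : ι} (hT : (S.erase i).Nonempty) {m k : ℕ}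
    (hk : k < m) : δ ≤ #S * siteBirth r S i m k := by
  obtain ⟨l, rfl⟩ : ∃ l, m = l + 1 + k := ⟨m - 1 - k, by omega⟩
  have e1 : l + 1 + k - 1 - k = l := by omega
  have e2 : l + 1 + k - k = l + 1 := by omega
  rw [siteBirth, if_pos hk, e1, e2, ← mul_div_assoc, le_div_iff₀ (partition_pos hr hT _)]
  have h1 := mul_partition_succ_le (S := S.erase i) hr l
  have h2 : (#(S.erase i) : ℝ) ≤ #S := by exact_mod_cast card_le_card (erase_subset i S)
  have h3 := mul_le_mul_of_nonneg_right h2 (partition_pos hr hT l).le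
  have h4 : 0 ≤ δ * l * partition r (S.erase i) (l + 1) :=
    mul_nonneg (mul_nonneg hr.pos.le l.cast_nonneg) (partition_pos hr hT _).le
  linarith

theorem hasLogRatio (hr : IsRate δ Δ r) {i : ι} (hi : i ∈ S) (hT : (S.erase i).Nonempty) {m : ℕ}
    (hm : 1 ≤ m) {Λ : ℝ} (hΛ : Δ * m * #S ≤ Real.exp Λ * δ) :
    IsMonotoneBirthDeath.HasLogRatio m δ Λ (siteBirth r S i m) (r i) := by
  have hδ := hr.pos
  have hδΔ : δ ≤ Δ := (hr.gap i 0).trans (hr.gap_le i 0)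
  have hΔ := hδ.trans_le hδΔ
  have hm' : (1 : ℝ) ≤ m := by exact_mod_cast hm
  have hS : (2 : ℝ) ≤ #S := by
    have := card_erase_of_mem hi
    have := hT.card_pos
    have : 2 ≤ #S := by omega
    exact_mod_cast this
  have hM : δ ≤ Δ * m := hδΔ.trans (le_mul_of_one_le_right hΔ.le hm')
  have hexit : ∀ k ≤ m, δ + siteBirth r S i m k + r i k ≤ 2 * (Δ * m) := by
    intro k hk
    linarith [siteBirth_le hr hT hk, hr.le_mul i k]
  have hMS : 2 * (Δ * m) ≤ Δ * m * #S := by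
    rw [mul_comm]
    exact mul_le_mul_of_nonneg_left hS (hδ.le.trans hM)
  have hexp : Real.exp (2 * Λ) = Real.exp Λ * Real.exp Λ := by rw [← Real.exp_add]; ring_nf
  have hmin : ∀ q : ℝ, δ ≤ #S * q → 2 * (Δ * m) ≤ Real.exp (2 * Λ) * q := by
    intro q hq
    have hE := Real.exp_pos Λ
    have h1 : #S ≤ Real.exp Λ := by
      refine le_of_mul_le_mul_right ?_ hδ
      have := mul_le_mul_of_nonneg_right hM (by linarith : (0 : ℝ) ≤ #S)
      linarith
    have hq0 : 0 ≤ q := by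
      have : 0 < #S * q := hδ.trans_le hq
      exact ((mul_pos_iff_of_pos_left (by linarith)).1 this).le
    have h2 : #S * q ≤ Real.exp Λ * q := mul_le_mul_of_nonneg_right h1 hq0
    have h3 : Real.exp Λ * δ ≤ Real.exp Λ * (Real.exp Λ * q) :=
      mul_le_mul_of_nonneg_left (hq.trans h2) hE.le
    rw [hexp]
    linarith
  refine ⟨?_, fun k hk => ?_, fun k hk => ?_, fun k hk => ?_⟩
  · have h1 : (2 : ℝ) ≤ Real.exp Λ := by
      refine le_of_mul_le_mul_right ?_ hδ
      linarith
    have h2 := Real.log_le_log two_pos h1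
    rw [Real.log_exp] at h2
    linarith [Real.log_two_gt_d9]
  · exact (hexit k hk).trans (hMS.trans hΛ)
  · exact (hexit k hk.le).trans (hmin _ (le_mul_siteBirth hr hT hk))
  · refine (hexit (k + 1) hk).trans (hmin _ ?_)
    have h1 : δ ≤ r i (k + 1) := by linarith [hr.gap i k, hr.nonneg i k]
    have h2 := hr.nonneg i (k + 1)
    nlinarith

/-- The conditional expectation of `f` given that the site `i` holds `k` of the `m` particles. -/
noncomputable def siteMean (r : ι → ℕ → ℝ) (S : Finset ι) (i : ι) (m : ℕ) (f : (ι → ℕ) → ℝ)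
    (k : ℕ) : ℝ :=
  (∑ y ∈ piAntidiag (S.erase i) (m - k), weight r y * f (y + Pi.single i k))
    / partition r (S.erase i) (m - k)

theorem siteMean_pos (hr : IsRate δ Δ r) {i : ι} (hT : (S.erase i).Nonempty) (m : ℕ)
    {f : (ι → ℕ) → ℝ} (hf : ∀ x, 0 < f x) (k : ℕ) : 0 < siteMean r S i m f k := by
  have h0 := partition_pos hr hT (m - k)
  refine div_pos (sum_pos (fun y _ => mul_pos (weight_pos hr y) (hf _)) ?_) h0
  exact nonempty_of_sum_ne_zero h0.ne'

theorem sum_siteWeight_mul {i : ι} (hi : i ∈ S) (r : ι → ℕ → ℝ) (l : ℕ) (G : (ι → ℕ) → ℝ) :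
    ∑ k ∈ range (l + 1), siteWeight r i k *
        ∑ y ∈ piAntidiag (S.erase i) (l - k), weight r y * G (y + Pi.single i k)
      = ∑ y ∈ piAntidiag S l, weight r y * G y := by
  rw [sum_piAntidiag_eq hi]
  refine sum_congr rfl fun k _ => ?_
  rw [mul_sum]
  refine sum_congr rfl fun y hy => ?_
  rw [weight_add_single r (apply_eq_zero_of_mem_erase hy), mul_assoc]

/-- The chain rule for the entropy, conditioning on the number of particles at the site `i`. -/
theorem weightedEntropy_eq (hr : IsRate δ Δ r) {i : ι} (hi : i ∈ S) (hT : (S.erase i).Nonempty)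
    (m : ℕ) (f : (ι → ℕ) → ℝ) :
    weightedEntropy (piAntidiag S m) (weight r) f
      = ∑ k ∈ range (m + 1), siteWeight r i k *
          weightedEntropy (piAntidiag (S.erase i) (m - k)) (weight r)
            (fun y => f (y + Pi.single i k))
        + weightedEntropy (range (m + 1)) (siteLaw r S i m) (siteMean r S i m f) := by
  have hsplit := sum_siteWeight_mul hi r m
  have hZ : ∑ x ∈ piAntidiag S m, weight r x = ∑ k ∈ range (m + 1), siteLaw r S i m k := by
    simpa [siteLaw, partition] using (hsplit fun _ => 1).symm
  have hlaw : ∀ k, siteLaw r S i m k * siteMean r S i m f k = siteWeight r i k *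
      ∑ y ∈ piAntidiag (S.erase i) (m - k), weight r y * f (y + Pi.single i k) := by
    intro k
    rw [siteLaw, siteMean, mul_assoc, mul_div_cancel₀ _ (partition_pos hr hT _).ne']
  have hlog : ∀ k, siteLaw r S i m k * (siteMean r S i m f k * Real.log (siteMean r S i m f k))
      = siteWeight r i k * (∑ y ∈ piAntidiag (S.erase i) (m - k),
        weight r y * f (y + Pi.single i k)) * Real.log (siteMean r S i m f k) := by
    intro k
    rw [← hlaw, mul_assoc]
  unfold weightedEntropy
  rw [← hsplit f, ← hsplit fun x => f x * Real.log (f x), hZ]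
  simp only [hlaw, hlog]
  rw [← add_sub_assoc, ← sum_add_distrib]
  congr 1
  refine sum_congr rfl fun k _ => ?_
  rw [siteMean, partition]
  ring

/-! ### The log-Sobolev inequality for the reversible weight -/

/-- The Dirichlet form of the zero-range process on `S` with `l + 1` particles evaluated at
`(√f, √f)`, multiplied by twice the number of sites. An edge of the process is a configuration `y`
of `l` particles with one more particle that may be at either of two sites; by reversibility the
weight of the edge is that of `y`. -/
noncomputable def edgeEnergy (r : ι → ℕ → ℝ) (S : Finset ι) (l : ℕ) (f : (ι → ℕ) → ℝ) : ℝ :=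
  ∑ y ∈ piAntidiag S l, weight r y *
    ∑ a ∈ S, ∑ c ∈ S, (√(f (y + Pi.single a 1)) - √(f (y + Pi.single c 1))) ^ 2

/-- The part of `edgeEnergy` carried by the jumps out of the site `i`. -/
noncomputable def siteEnergy (r : ι → ℕ → ℝ) (S : Finset ι) (l : ℕ) (f : (ι → ℕ) → ℝ) (i : ι) :
    ℝ :=
  ∑ y ∈ piAntidiag S l, weight r y *
    ∑ c ∈ S, (√(f (y + Pi.single i 1)) - √(f (y + Pi.single c 1))) ^ 2

theorem sum_siteEnergy (r : ι → ℕ → ℝ) (S : Finset ι) (l : ℕ) (f : (ι → ℕ) → ℝ) :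
    ∑ i ∈ S, siteEnergy r S l f i = edgeEnergy r S l f := by
  unfold siteEnergy edgeEnergy
  rw [sum_comm]
  simp only [mul_sum]

theorem edgeEnergy_nonneg (hr : IsRate δ Δ r) (l : ℕ) (f : (ι → ℕ) → ℝ) :
    0 ≤ edgeEnergy r S l f :=
  sum_nonneg fun y _ => mul_nonneg (weight_pos hr y).le
    (sum_nonneg fun _ _ => sum_nonneg fun _ _ => sq_nonneg _)

/-- Freezing the site `i` discards the jumps in and out of `i`. -/
theorem sum_siteWeight_mul_edgeEnergy {i : ι} (hi : i ∈ S) (r : ι → ℕ → ℝ) (l : ℕ)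
    (f : (ι → ℕ) → ℝ) :
    ∑ k ∈ range (l + 1), siteWeight r i k *
        edgeEnergy r (S.erase i) (l - k) (fun y => f (y + Pi.single i k))
      = edgeEnergy r S l f - 2 * siteEnergy r S l f i := by
  have h1 := sum_siteWeight_mul hi r l fun y => ∑ a ∈ S.erase i, ∑ c ∈ S.erase i,
    (√(f (y + Pi.single a 1)) - √(f (y + Pi.single c 1))) ^ 2
  simp only [edgeEnergy, add_right_comm _ (Pi.single _ 1) (Pi.single i _)]
  rw [h1, siteEnergy, mul_sum, ← sum_sub_distrib]
  refine sum_congr rfl fun y _ => ?_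
  set φ : ι → ι → ℝ := fun a c => (√(f (y + Pi.single a 1)) - √(f (y + Pi.single c 1))) ^ 2
  have hsymm : ∀ a c, φ a c = φ c a := fun a c => sub_sq_comm _ _
  have hdiag : φ i i = 0 := by simp [φ]
  have e1 : ∀ g : ι → ℝ, ∑ a ∈ S.erase i, g a = ∑ a ∈ S, g a - g i := fun g => by
    rw [← add_sum_erase S g hi]; ring
  have e2 : ∑ a ∈ S, φ a i = ∑ a ∈ S, φ i a := sum_congr rfl fun a _ => hsymm a i
  change weight r y * ∑ a ∈ S.erase i, ∑ c ∈ S.erase i, φ a c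
    = weight r y * ∑ a ∈ S, ∑ c ∈ S, φ a c - 2 * (weight r y * ∑ c ∈ S, φ i c)
  simp only [e1, sum_sub_distrib, e2, hdiag]
  ring

/-- The energy of the one-site chain is dominated by the energy of the jumps out of that site. The
conditional equilibria given `k + 1` and given `k` particles at `i` are coupled so that they differ
by the position of a single particle; the bound then follows from joint convexity. -/
theorem energy_siteMean_le (hr : IsRate δ Δ r) {i : ι} (hi : i ∈ S) (hT : (S.erase i).Nonempty)
    (l : ℕ) {f : (ι → ℕ) → ℝ} (hf : ∀ x, 0 < f x) :
    IsMonotoneBirthDeath.energy (l + 1) (siteLaw r S i (l + 1)) (siteBirth r S i (l + 1))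
        (siteMean r S i (l + 1) f)
      ≤ Δ / δ / #(S.erase i) * siteEnergy r S l f i := by
  have h1 := sum_siteWeight_mul hi r l fun y =>
    ∑ c ∈ S, (√(f (y + Pi.single i 1)) - √(f (y + Pi.single c 1))) ^ 2
  rw [siteEnergy, ← h1, IsMonotoneBirthDeath.energy, mul_sum]
  refine sum_le_sum fun k hk => ?_
  have hk := mem_range.1 hk
  rw [siteLaw_mul_siteBirth hr hT hk, Nat.add_sub_cancel, mul_assoc, mul_left_comm (Δ / δ / _)]
  refine mul_le_mul_of_nonneg_left ?_ (siteWeight_pos hr i k).le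
  set T := S.erase i with hTdef
  have e1 : l + 1 - (k + 1) = l - k := by omega
  have e2 : l + 1 - k = l - k + 1 := by omega
  obtain ⟨K, hK0, hK1, hKle, hK⟩ := exists_coupling hr hT (l - k)
  have hZ := partition_pos hr hT (l - k)
  have hZ' := partition_pos hr hT (l - k + 1)
  set P := piAntidiag T (l - k) ×ˢ T
  have hF1 : partition r T (l - k) * siteMean r S i (l + 1) f (k + 1)
      = ∑ q ∈ P, weight r q.1 * K q.1 q.2 * f (q.1 + Pi.single i (k + 1)) := by
    rw [siteMean, e1, ← hTdef, mul_div_cancel₀ _ hZ.ne', sum_product]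
    refine sum_congr rfl fun x hx => ?_
    simp only [← sum_mul, ← mul_sum, hK1 x hx, mul_one]
  have hF2 : partition r T (l - k) * siteMean r S i (l + 1) f k
      = ∑ q ∈ P, weight r q.1 * K q.1 q.2 * f (q.1 + Pi.single q.2 1 + Pi.single i k) := by
    have hKf := hK fun y => f (y + Pi.single i k)
    beta_reduce at hKf
    rw [siteMean, e2, ← hTdef, ← mul_div_assoc, ← hKf, mul_div_cancel_left₀ _ hZ'.ne', sum_product]
    refine sum_congr rfl fun x hx => ?_
    rw [mul_sum]
    exact sum_congr rfl fun j _ => by ring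
  have hconv := sq_sqrt_sum_mul_sub_sqrt_sum_mul_le P (fun q => weight r q.1 * K q.1 q.2)
    (fun q => f (q.1 + Pi.single i (k + 1)))
    (fun q => f (q.1 + Pi.single q.2 1 + Pi.single i k))
    (fun q _ => mul_nonneg (weight_pos hr _).le (hK0 _ _)) (fun q _ => (hf _).le)
    (fun q _ => (hf _).le)
  rw [← hF1, ← hF2, Real.sqrt_mul hZ.le, Real.sqrt_mul hZ.le, ← mul_sub, mul_pow,
    Real.sq_sqrt hZ.le, sum_product] at hconv
  refine hconv.trans ?_
  rw [mul_sum]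
  refine sum_le_sum fun x hx => ?_
  rw [mul_left_comm]
  simp only [mul_assoc]
  rw [← mul_sum]
  refine mul_le_mul_of_nonneg_left ?_ (weight_pos hr x).le
  have hC : 0 ≤ Δ / δ / #T := (hK0 _ _).trans (hKle x hx _ hT.choose_spec)
  calc _ ≤ ∑ c ∈ T, Δ / δ / #T *
        (√(f (x + Pi.single i (k + 1))) - √(f (x + Pi.single c 1 + Pi.single i k))) ^ 2 :=
      sum_le_sum fun c hc => mul_le_mul_of_nonneg_right (hKle x hx c hc) (sq_nonneg _)
    _ = Δ / δ / #T * ∑ c ∈ T,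
        (√(f (x + Pi.single i k + Pi.single i 1))
          - √(f (x + Pi.single i k + Pi.single c 1))) ^ 2 := by
      rw [mul_sum]
      refine sum_congr rfl fun c _ => ?_
      rw [add_right_comm x (Pi.single c 1), add_assoc x (Pi.single i k) (Pi.single i 1),
        ← Pi.single_add]
    _ ≤ _ := by
      refine mul_le_mul_of_nonneg_left ?_ hC
      exact sum_le_sum_of_subset_of_nonneg (erase_subset i S) fun c _ _ => sq_nonneg _

/-- The log-Sobolev inequality for the reversible weight, by induction on the number of sites: the
chain rule for the entropy at a site `i` is averaged over `i ∈ S`. -/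
theorem card_mul_weightedEntropy_le (hr : IsRate δ Δ r) {Λ : ℝ} {l : ℕ} (hS : S.Nonempty)
    (hΛ : Δ * (l + 1) * #S ≤ Real.exp Λ * δ) {f : (ι → ℕ) → ℝ} (hf : ∀ x, 0 < f x) :
    #S * weightedEntropy (piAntidiag S (l + 1)) (weight r) f
      ≤ 20 * Λ / δ * (Δ / δ) * edgeEnergy r S l f := by
  have hδ := hr.pos
  have hδΔ : δ ≤ Δ := (hr.gap hS.choose 0).trans (hr.gap_le hS.choose 0)
  have hΔ := hδ.trans_le hδΔ
  induction hn : #S using Nat.strong_induction_on generalizing S l f with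
  | _ n ih =>
    subst hn
    have hΛ0 : 0 ≤ Λ := by
      have h1 : (1 : ℝ) ≤ #S := by exact_mod_cast hS.card_pos
      have h2 : (1 : ℝ) ≤ (l + 1) * #S := one_le_mul_of_one_le_of_one_le (by simp) h1
      have h3 : 1 * δ ≤ Real.exp Λ * δ := by
        have := mul_le_mul_of_nonneg_left h2 hΔ.le
        linarith
      exact Real.one_le_exp_iff.1 (le_of_mul_le_mul_right h3 hδ)
    rcases (Nat.succ_le_of_lt hS.card_pos).eq_or_lt with h1 | h1
    · obtain ⟨i, rfl⟩ := card_eq_one.1 h1.symm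
      have e : piAntidiag {i} (l + 1) = {Pi.single i (l + 1)} := by
        ext x
        rw [mem_piAntidiag, mem_singleton, sum_singleton]
        constructor
        · rintro ⟨h2, h3⟩
          ext j
          by_cases hj : j = i
          · subst hj; simp [h2]
          · rw [Pi.single_eq_of_ne hj]
            by_contra h4
            exact hj (mem_singleton.1 (h3 j h4))
        · rintro rfl
          refine ⟨by simp, fun j hj => ?_⟩
          by_contra h4
          exact hj (Pi.single_eq_of_ne (fun h => h4 (mem_singleton.2 h)) _)
      rw [e, weightedEntropy_singleton _ (weight_pos hr _).ne', mul_zero]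
      have := edgeEnergy_nonneg (S := {i}) hr l f
      positivity
    · set c := 20 * Λ / δ * (Δ / δ) with hc
      set E := weightedEntropy (piAntidiag S (l + 1)) (weight r) f with hE
      have hcard : ∀ i ∈ S, (#(S.erase i) : ℝ) = #S - 1 := fun i hi => by
        rw [card_erase_of_mem hi, Nat.cast_sub hS.card_pos, Nat.cast_one]
      have hcard0 : (0 : ℝ) < #S - 1 := by
        have : (1 : ℝ) < #S := by exact_mod_cast h1
        linarith
      have hsite : ∀ i ∈ S, (#S - 1) * E ≤ c * (edgeEnergy r S l f - siteEnergy r S l f i) := by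
        intro i hi
        have hTcard : #(S.erase i) < #S := card_erase_lt_of_mem hi
        have hT : (S.erase i).Nonempty := card_pos.1 (by rw [card_erase_of_mem hi]; omega)
        have hcond : (#S - 1) * ∑ k ∈ range (l + 1 + 1), siteWeight r i k *
            weightedEntropy (piAntidiag (S.erase i) (l + 1 - k)) (weight r)
              (fun y => f (y + Pi.single i k))
            ≤ c * (edgeEnergy r S l f - 2 * siteEnergy r S l f i) := by
          rw [← sum_siteWeight_mul_edgeEnergy hi, sum_range_succ, Nat.sub_self, piAntidiag_zero,
            weightedEntropy_singleton _ (weight_pos hr _).ne', mul_zero, add_zero, mul_sum, mul_sum]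
          refine sum_le_sum fun k hk => ?_
          have hk := Nat.lt_succ_iff.1 (mem_range.1 hk)
          have hΛ' : Δ * ((l - k : ℕ) + 1) * #(S.erase i) ≤ Real.exp Λ * δ := by
            refine le_trans ?_ hΛ
            have h2 : ((l - k : ℕ) : ℝ) ≤ l := by exact_mod_cast Nat.sub_le l k
            have h3 : (#(S.erase i) : ℝ) ≤ #S := by exact_mod_cast hTcard.le
            gcongr
          have h4 := ih _ hTcard hT hΛ' (f := fun y => f (y + Pi.single i k)) (fun x => hf _) rfl
          rw [hcard i hi, show l - k + 1 = l + 1 - k by omega] at h4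
          have := mul_le_mul_of_nonneg_left h4 (siteWeight_pos hr i k).le
          linarith
        have hmarg : (#S - 1) * weightedEntropy (range (l + 1 + 1)) (siteLaw r S i (l + 1))
            (siteMean r S i (l + 1) f) ≤ c * siteEnergy r S l f i := by
          have h2 := (isMonotoneBirthDeath hr hT (l + 1)).logSobolev
            (hasLogRatio hr hi hT (by omega) (by push_cast; exact hΛ))
            (f := siteMean r S i (l + 1) f) fun k _ => siteMean_pos hr hT _ hf k
          have h3 := mul_le_mul_of_nonneg_left (energy_siteMean_le hr hi hT l hf)
            (by positivity : 0 ≤ 20 * Λ / δ)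
          have h4 := mul_le_mul_of_nonneg_left (h2.trans h3) hcard0.le
          refine h4.trans_eq ?_
          rw [hcard i hi, hc]
          field_simp
        rw [hE, weightedEntropy_eq hr hi hT (l + 1) f, mul_add]
        linarith
      -- As the `siteEnergy` add up to one `edgeEnergy`, the factor `#S - 1` appears on both sides.
      have hsum := sum_le_sum hsite
      rw [sum_const, nsmul_eq_mul, ← mul_sum, sum_sub_distrib, sum_siteEnergy, sum_const,
        nsmul_eq_mul] at hsum
      refine le_of_mul_le_mul_left ?_ hcard0
      linarith

end ZeroRange

/-! ### The Markov chain on configurations -/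

namespace ZeroRange

open Finset

variable {m n : ℕ} {δ Δ : ℝ} {r : Fin n → ℕ → ℝ}

theorem move_val {x : Config m n} {i : Fin n} (h : 0 < x.1 i) (j : Fin n) :
    (move x i j).1 = x.1 - Pi.single i 1 + Pi.single j 1 := by
  rw [move, dif_pos h]

theorem sum_config (F : (Fin n → ℕ) → ℝ) :
    ∑ x : Config m n, F x.1 = ∑ x ∈ piAntidiag univ m, F x :=
  (sum_subtype _ (fun x => by simp) F).symm

theorem sum_rate_mul (r : Fin n → ℕ → ℝ) (G : Matrix (Fin n) (Fin n) ℝ) (x : Config m n)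
    (H : Config m n → ℝ) :
    ∑ y, rate r G x y * H y = ∑ i, ∑ j, r i (x.1 i) * G i j * (H (move x i j) - H x) := by
  have hsingle : ∀ z : Config m n, ∑ y, (Pi.single y 1 : Config m n → ℝ) z * H y = H z := by
    intro z
    rw [sum_eq_single z (fun y _ hy => by rw [Pi.single_eq_of_ne hy.symm, zero_mul])
      (fun h => absurd (mem_univ z) h), Pi.single_eq_same, one_mul]
  simp only [rate, generator, sum_mul]
  rw [sum_comm]
  refine sum_congr rfl fun i _ => ?_
  rw [sum_comm]
  refine sum_congr rfl fun j _ => ?_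
  simp only [mul_assoc, ← mul_sum, sub_mul, sum_sub_distrib, hsingle]

/-- The configuration obtained from `y` by adding a particle at `i`. -/
def addParticle {l : ℕ} (y : Config l n) (i : Fin n) : Config (l + 1) n :=
  ⟨y.1 + Pi.single i 1, by simp [sum_add_distrib, y.2]⟩

theorem rate_addParticle (hr : IsRate δ Δ r) (G : Matrix (Fin n) (Fin n) ℝ) {l : ℕ}
    (y : Config l n) {i j : Fin n} (hij : i ≠ j) :
    rate r G (addParticle y i) (addParticle y j) = r i (y.1 i + 1) * G i j := by
  have hval : ∀ k, (addParticle y k).1 = y.1 + Pi.single k 1 := fun _ => rfl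
  have hne : addParticle y i ≠ addParticle y j := by
    intro h
    have := congrFun (congrArg Subtype.val h) i
    simp [hval, hij] at this
  have hmove : ∀ a b, 0 < (addParticle y i).1 a →
      (move (addParticle y i) a b = addParticle y j ↔ a = i ∧ b = j) := by
    intro a b ha
    rw [Subtype.ext_iff, move_val ha, hval, hval]
    rw [hval] at ha
    constructor
    · intro h
      have h1 : (Pi.single i 1 + Pi.single b 1 : Fin n → ℕ) = Pi.single a 1 + Pi.single j 1 := by
        have h2 : y.1 + Pi.single i 1 + Pi.single b 1 = y.1 + Pi.single j 1 + Pi.single a 1 := by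
          rw [← h, add_right_comm _ (Pi.single b 1), sub_single_add_single ha]
        rw [add_assoc, add_assoc] at h2
        rw [add_left_cancel h2, add_comm]
      have hai : a = i := by
        have := congrFun h1 i
        by_contra hai
        simp [Pi.single_eq_of_ne hij, Pi.single_eq_of_ne (Ne.symm hai)] at this
      subst hai
      refine ⟨rfl, ?_⟩
      have h3 := congrFun (add_left_cancel h1) j
      by_contra hbj
      simp [Pi.single_eq_of_ne (Ne.symm hbj)] at h3
    · rintro ⟨rfl, rfl⟩
      rw [add_tsub_cancel_right]
  have hterm : ∀ a b, r a ((addParticle y i).1 a) * G a b *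
        ((Pi.single (addParticle y j) 1 : Config (l + 1) n → ℝ) (move (addParticle y i) a b)
          - (Pi.single (addParticle y j) 1 : Config (l + 1) n → ℝ) (addParticle y i))
      = if a = i ∧ b = j then r i (y.1 i + 1) * G i j else 0 := by
    intro a b
    rw [Pi.single_eq_of_ne hne, sub_zero]
    rcases Nat.eq_zero_or_pos ((addParticle y i).1 a) with h0 | h0
    · rw [h0, hr.zero, zero_mul, zero_mul, if_neg]
      rintro ⟨rfl, -⟩
      simp [hval] at h0
    · split_ifs with hab
      · rw [(hmove a b h0).2 hab, Pi.single_eq_same, mul_one, hab.1, hab.2, hval]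
        simp
      · rw [Pi.single_eq_of_ne fun h => hab ((hmove a b h0).1 h), mul_zero]
  simp only [rate, generator, hterm, ite_and, sum_ite_eq', sum_const_zero, mem_univ, if_true,
    sum_ite_irrel]

/-- The reversible probability vector is proportional to the reversible weight. -/
theorem exists_eq_mul_weight (hr : IsRate δ Δ r) {l : ℕ} (hn : 1 ≤ n) {π : Config (l + 1) n → ℝ}
    (hπ : MarkovChain.IsReversible (rate r (meanField n)) π) :
    ∃ c, 0 < c ∧ (∀ x, π x = c * weight r x.1) ∧
      c * partition r (univ : Finset (Fin n)) (l + 1) = 1 := by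
  have hn' : (0 : ℝ) < n := by exact_mod_cast hn
  let ρ : (Fin n → ℕ) → ℝ := fun x =>
    if h : ∑ i, x i = l + 1 then π ⟨x, h⟩ / weight r x else 0
  have hρ : ∀ x : Config (l + 1) n, π x = ρ x.1 * weight r x.1 := by
    intro x
    simp only [ρ, dif_pos x.2]
    rw [div_mul_cancel₀ _ (weight_pos hr _).ne']
  have hconst : ∀ y ∈ piAntidiag (univ : Finset (Fin n)) l, ∀ i ∈ (univ : Finset (Fin n)),
      ∀ k ∈ (univ : Finset (Fin n)), ρ (y + Pi.single i 1) = ρ (y + Pi.single k 1) := by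
    intro y hy i _ k _
    rcases eq_or_ne i k with rfl | hik
    · rfl
    have hy' : ∑ j, y j = l := (mem_piAntidiag.1 hy).1
    have hdb := hπ.detailed_balance (addParticle ⟨y, hy'⟩ i) (addParticle ⟨y, hy'⟩ k)
    rw [rate_addParticle hr _ _ hik, rate_addParticle hr _ _ hik.symm, hρ, hρ] at hdb
    simp only [addParticle, meanField] at hdb
    have h1 := weight_add_single_mul hr y i
    have h2 := weight_add_single_mul hr y k
    have hw := weight_pos hr y
    have h3 : ρ (y + Pi.single i 1) * (weight r y / n)
        = ρ (y + Pi.single k 1) * (weight r y / n) := by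
      nth_rewrite 1 [← h1]
      rw [← h2]
      linear_combination hdb
    exact mul_right_cancel₀ (by positivity) h3
  have hS : (univ : Finset (Fin n)).Nonempty := ⟨⟨0, hn⟩, mem_univ _⟩
  have hZ := partition_pos hr hS (l + 1)
  obtain ⟨x₀, hx₀⟩ : (piAntidiag (univ : Finset (Fin n)) (l + 1)).Nonempty :=
    nonempty_of_sum_ne_zero hZ.ne'
  have hπc : ∀ x, π x = ρ x₀ * weight r x.1 := by
    intro x
    have hx : x.1 ∈ piAntidiag (univ : Finset (Fin n)) (l + 1) := by simp [x.2]
    rw [hρ, eq_of_forall_add_single_eq hconst hx hx₀]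
  have hmass : ρ x₀ * partition r (univ : Finset (Fin n)) (l + 1) = 1 := by
    rw [← hπ.sum_eq_one, sum_congr rfl fun x _ => hπc x, ← mul_sum, sum_config, partition]
  exact ⟨ρ x₀, pos_of_mul_pos_left (hmass ▸ one_pos) hZ.le, hπc, hmass⟩

theorem dirichletForm_eq (hr : IsRate δ Δ r) {l : ℕ} {π : Config (l + 1) n → ℝ} {c : ℝ}
    (hπ : ∀ x, π x = c * weight r x.1) (f : (Fin n → ℕ) → ℝ) :
    MarkovChain.dirichletForm (rate r (meanField n)) π (fun x => √(f x.1)) (fun x => √(f x.1))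
      = c / (2 * n) * edgeEnergy r univ l f := by
  have h1 : ∀ x : Config (l + 1) n,
      ∑ y : Config (l + 1) n, π x * rate r (meanField n) x y
          * (√(f x.1) - √(f y.1)) * (√(f x.1) - √(f y.1))
        = c / n * ∑ i, ∑ j, weight r x.1 * (r i (x.1 i) *
          (√(f x.1) - √(f (x.1 - Pi.single i 1 + Pi.single j 1))) ^ 2) := by
    intro x
    have h2 := sum_rate_mul r (meanField n) x fun y => (√(f x.1) - √(f y.1)) ^ 2
    simp only [sub_self, zero_pow two_ne_zero, sub_zero] at h2
    have h3 : ∑ y : Config (l + 1) n, π x * rate r (meanField n) x y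
          * (√(f x.1) - √(f y.1)) * (√(f x.1) - √(f y.1))
        = π x * ∑ y, rate r (meanField n) x y * (√(f x.1) - √(f y.1)) ^ 2 := by
      rw [mul_sum]
      exact sum_congr rfl fun y _ => by ring
    rw [h3, h2, hπ, mul_sum, mul_sum]
    refine sum_congr rfl fun i _ => ?_
    rw [mul_sum, mul_sum]
    refine sum_congr rfl fun j _ => ?_
    rcases Nat.eq_zero_or_pos (x.1 i) with h0 | h0
    · rw [h0, hr.zero]; ring
    · rw [move_val h0, meanField]; ring
  have h4 : ∑ x ∈ piAntidiag univ (l + 1), ∑ i, ∑ j, weight r x * (r i (x i) *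
          (√(f x) - √(f (x - Pi.single i 1 + Pi.single j 1))) ^ 2)
      = ∑ y ∈ piAntidiag univ l, weight r y *
    ∑ a, ∑ c, (√(f (y + Pi.single a 1)) - √(f (y + Pi.single c 1))) ^ 2 := by
    simp only [mul_sum]
    rw [sum_comm, sum_comm (s := piAntidiag univ l)]
    refine sum_congr rfl fun i hi => ?_
    rw [sum_comm, sum_comm (s := piAntidiag univ l)]
    refine sum_congr rfl fun j _ => ?_
    rw [sum_weight_mul_rate hr hi]
    simp only [add_tsub_cancel_right]
  have h5 := sum_config (m := l + 1) fun x : Fin n → ℕ => ∑ i, ∑ j, weight r x * (r i (x i) *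
    (√(f x) - √(f (x - Pi.single i 1 + Pi.single j 1))) ^ 2)
  unfold MarkovChain.dirichletForm edgeEnergy
  rw [sum_congr rfl fun x _ => h1 x, ← mul_sum]
  refine (congrArg (fun z => 1 / 2 * (c / n * z)) (h5.trans h4)).trans ?_
  ring

theorem entropy_eq {π : Config m n → ℝ} {c : ℝ} (hπ : ∀ x, π x = c * weight r x.1)
    (hc : c * partition r (univ : Finset (Fin n)) m = 1) (f : (Fin n → ℕ) → ℝ) :
    MarkovChain.entropy π (fun x => f x.1)
      = c * weightedEntropy (piAntidiag univ m) (weight r) f := by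
  have hsum : ∀ G : (Fin n → ℕ) → ℝ, ∑ x : Config m n, π x * G x.1
      = c * ∑ x ∈ piAntidiag univ m, weight r x * G x := by
    intro G
    rw [mul_sum, ← sum_config fun x => c * (weight r x * G x)]
    exact sum_congr rfl fun x _ => by rw [hπ, mul_assoc]
  unfold MarkovChain.entropy MarkovChain.expect weightedEntropy
  rw [hsum f, hsum fun x => f x * Real.log (f x), ← partition, eq_div_of_mul_eq
    (right_ne_zero_of_mul_eq_one hc) hc, one_div_mul_eq_div, one_div_mul_eq_div]
  ring

/-- The log-Sobolev inequality for the mean-field zero-range process. -/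
theorem logSobolev_meanField (hr : IsRate δ Δ r) {l : ℕ} (hn : 1 ≤ n) {π : Config (l + 1) n → ℝ}
    (hπ : MarkovChain.IsReversible (rate r (meanField n)) π) :
    MarkovChain.LogSobolev (rate r (meanField n)) π
      (40 * Δ / δ ^ 2 * Real.log (Δ * (l + 1) * n / δ)) := by
  intro f hf
  have hδ := hr.pos
  have hΔ : 0 < Δ := hδ.trans_le ((hr.gap ⟨0, hn⟩ 0).trans (hr.gap_le ⟨0, hn⟩ 0))
  have hn' : (0 : ℝ) < n := by exact_mod_cast hn
  obtain ⟨c, hc, hπc, hcZ⟩ := exists_eq_mul_weight hr hn hπ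
  obtain ⟨g, hg, hfg⟩ : ∃ g : (Fin n → ℕ) → ℝ, (∀ x, 0 < g x) ∧ f = fun x => g x.1 := by
    refine ⟨fun x => if h : ∑ i, x i = l + 1 then f ⟨x, h⟩ else 1, fun x => ?_, ?_⟩
    · dsimp only
      split_ifs
      · exact hf _
      · exact one_pos
    · ext x
      simp only [dif_pos x.2]
  subst hfg
  have hS : (univ : Finset (Fin n)).Nonempty := ⟨⟨0, hn⟩, mem_univ _⟩
  have hΛ : Δ * (l + 1) * #(univ : Finset (Fin n))
      ≤ Real.exp (Real.log (Δ * (l + 1) * n / δ)) * δ := by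
    rw [Real.exp_log (by positivity), div_mul_cancel₀ _ hδ.ne', card_univ, Fintype.card_fin]
  have hmain := card_mul_weightedEntropy_le hr hS hΛ hg
  rw [card_univ, Fintype.card_fin] at hmain
  rw [entropy_eq hπc hcZ g, dirichletForm_eq hr hπc g]
  have h1 := mul_le_mul_of_nonneg_left hmain (div_pos hc hn').le
  calc _ = c / n * (n * weightedEntropy (piAntidiag univ (l + 1)) (weight r) g) := by field_simp
    _ ≤ _ := h1
    _ = _ := by field_simp; ring

end ZeroRange

theorem corollary4 (m n : ℕ) (hm : 1 ≤ m) (hn : 1 ≤ n)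
    (δ Δ : ℝ) (hδ : 0 < δ) (hΔ : 0 < Δ)
    (r : Fin n → ℕ → ℝ) (hr0 : ∀ i, r i 0 = 0)
    (hr : ∀ i k, δ ≤ r i (k + 1) - r i k ∧ r i (k + 1) - r i k ≤ Δ)
    (π : ZeroRange.Config m n → ℝ)
    (hπ : MarkovChain.IsReversible (ZeroRange.rate r (ZeroRange.meanField n)) π) :
    MarkovChain.logSobolevConst (ZeroRange.rate r (ZeroRange.meanField n)) π ≤
      ENNReal.ofReal (40 * Δ / δ ^ 2 * Real.log (Δ * m * n / δ)) := by
  obtain ⟨l, rfl⟩ : ∃ l, m = l + 1 := ⟨m - 1, by omega⟩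
  have hrate : ZeroRange.IsRate δ Δ r := ⟨hδ, hr0, fun i k => (hr i k).1, fun i k => (hr i k).2⟩
  have hLS := ZeroRange.logSobolev_meanField hrate hn hπ
  have hδΔ : δ ≤ Δ := (hr ⟨0, hn⟩ 0).1.trans (hr ⟨0, hn⟩ 0).2
  push_cast
  set t := 40 * Δ / δ ^ 2 * Real.log (Δ * (l + 1) * n / δ) with ht
  have ht0 : 0 ≤ t := by
    refine mul_nonneg (by positivity) (Real.log_nonneg ((one_le_div hδ).2 ?_))
    have h1 : (1 : ℝ) ≤ l + 1 := by simp
    have h2 : (1 : ℝ) ≤ n := by exact_mod_cast hn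
    exact hδΔ.trans ((le_mul_of_one_le_right hΔ.le h1).trans
      (le_mul_of_one_le_right (by positivity) h2))
  refine iInf₂_le_of_le t.toNNReal ?_ le_rfl
  rw [Real.coe_toNNReal t ht0]
  exact hLS
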